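/- Let $\mathbb{T}$ be a (many-sorted, relational) first-order geometric theory, i.e. a signature of sorts and relation symbols $R\subseteq X^1\times\dots\times X^k$ ($k\ge 0$) with a set of sequents $\phi\vdash_{x_1:X^1,\dots,x_k:X^k}\psi$, where $\phi,\psi$ are built from atoms $(x_1,\dots,x_k)\in R$ and $x=_X y$ by finite $\wedge$, set-indexed $\bigvee$ and $\exists$. *The propositional theory $P[\mathbb{T}]$.* It has basic propositions $[n\sim^X m]$ ($X$ a sort, $n,m\in\mathbb{N}$) and $[\vec n\in R]$ ($R\subseteq X^1\times\dots\times X^k$ a relation symbol, $\vec n\in\mathbb{N}^k$), and the axioms, for all natural numbers involved, $$[n\sim^X m]\vdash[m\sim^X n],\qquad [n\sim^X m]\wedge[m\sim^X \ell]\vdash[n\sim^X\ell],$$ $$[\vec n\in R]\wedge\bigwedge_i[n_i\sim^{X^i}m_i]\vdash[\vec m\in R],\qquad [\vec n\in R]\vdash\bigwedge_i[n_i\sim^{X^i}n_i],$$ $$\bigwedge_i[n_i\sim^{X^i}n_i]\wedge\phi_{\vec n}\vdash\psi_{\vec n}\quad\text{for each axiom }\phi\vdash_{x_1:X^1,\dots,x_k:X^k}\psi\text{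 of }\mathbb{T},$$ where $\phi_{\vec n}$ is obtained from $\phi$ by replacing $x_i$ by $n_i$, $\exists x:X.\,\chi$ by $\bigvee_{n\in\mathbb{N}}\chi(n)$, $\vec y\in R$ by $[\vec y\in R]$ and $x=_Xy$ by $[x\sim^Xy]$. Let $\mathcal{O}G_0^{\mathbb{T}}$ be the frame presented by these generators and relations (each $\phi\vdash\psi$ read as $\phi\le\psi$). *The theory $\mathbb{T}_{\cong}$.* It has two copies (indexed by $1$ and $2$) of the sorts, relation symbols and axioms of $\mathbb{T}$ and, for each sort $X$ of $\mathbb{T}$, a relation symbol $\alpha^X\subseteq X_1\times X_2$ with the axioms $$(x,y)\in\alpha^X\wedge(x',y')\in\alpha^X\wedge x=_{X_1}x'\ \dashv\vdash_{x,x':X_1,\,y,y':X_2}\ (x,y)\in\alpha^X\wedge(x',y')\in\alpha^X\wedge y=_{X_2}y',$$ $$\vdash_{y:X_2}\exists x:X_1.\,(x,y)\in\alpha^X,\qquad \vdash_{x:X_1}\exists y:X_2.\,(x,y)\in\alpha^X,$$ and, for each relation symbol $R\subseteq X^1\times\dots\times X^k$ of $\mathbb{T}$, the axiom $$\bigwedge_{i}(x_i,y_i)\in\alpha^{X^i}\wedge\vec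 x\in R_1\ \dashv\vdash_{\vec x,\vec y}\ \bigwedge_{i}(x_i,y_i)\in\alpha^{X^i}\wedge\vec y\in R_2 .$$ Let $\mathcal{O}G_1^{\mathbb{T}}$ be the frame presented by $P[\mathbb{T}_{\cong}]$, and write $[\alpha^X(n)=m]$ for $[(n,m)\in\alpha^X]$. The source map $s\colon G_1^{\mathbb{T}}\to G_0^{\mathbb{T}}$ is given by the frame homomorphism $s^*\colon\mathcal{O}G_0^{\mathbb{T}}\to\mathcal{O}G_1^{\mathbb{T}}$ with $[n\sim^Xm]\mapsto[n\sim^{X_1}m]$ and $[\vec n\in R]\mapsto[\vec n\in R_1]$. Below, $R$ may also be the equality relation $=_X$ of a sort $X$, in which case $[(n,m)\in R]$ means $[n\sim^Xm]$. **Statement.** The frame map $s^*$ has a left adjoint $s_!\colon\mathcal{O}G_1^{\mathbb{T}}\to\mathcal{O}G_0^{\mathbb{T}}$. It satisfies, for all finite families of basic propositions indexed by $I$, $J$, $K$, $$s_!\Big(\bigwedge_{i\in I}[\vec a^i\in R^i_1]\wedge\bigwedge_{j\in J}[\vec b^j\in R^j_2]\wedge\bigwedge_{k\in K}[\alpha^{X^k}(c^k)=d^k]\Big)=\bigwedge_{i\in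 I}[\vec a^i\in R^i]\wedge\bigvee_{\vec y\in\mathbb{N}^V}\Big(\bigwedge_{j\in J}[\vec\pi^j(\vec y)\in R^j]\wedge\bigwedge_{k\in K}[c^k\sim^{X^k}\pi^k(\vec y)]\Big),$$ and it is the only join-preserving map that does. Here $V$ is the set of pairs $(n,X)$ of a natural number and a sort such that $n$ is an entry of sort $X$ of some $\vec b^j$, or $(n,X)=(d^k,X^k)$ for some $k\in K$; $\vec\pi^j(\vec y)$ is the tuple of the values of $\vec y$ at the variables given by the entries of $\vec b^j$ with their sorts, and $\pi^k(\vec y)$ is the value of $\vec y$ at $(d^k,X^k)$. -/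

import Mathlib

universe u v w x

/-! ### Frames presented by generators and relations -/

/-- The free frame on a type `α` of generators: the down-sets of the free meet-semilattice on `α`,
which consists of the finite subsets of `α` ordered by reverse inclusion. -/
abbrev FreeFrame (α : Type u) : Type u := LowerSet (Finset α)ᵒᵈ

namespace FreeFrame

variable {α : Type u} {M : Type v} [Order.Frame M]

/-- A generator of the free frame. -/
def gen (a : α) : FreeFrame α := LowerSet.Iic (OrderDual.toDual {a})

/-- The frame homomorphism out of a free frame that extends a map on the generators. -/
def lift (f : α → M) : FrameHom (FreeFrame α) M where
  toFun U := ⨆ F ∈ U, ⨅ a ∈ OrderDual.ofDual F, f a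
  map_inf' U W := by
    classical
    apply le_antisymm
    · refine le_inf ?_ ?_ <;> refine iSup₂_le fun F hF => ?_
      · exact le_iSup₂_of_le F hF.1 le_rfl
      · exact le_iSup₂_of_le F hF.2 le_rfl
    · simp only [iSup_inf_eq, inf_iSup_eq]
      refine iSup₂_le fun H hH => iSup₂_le fun F hF => ?_
      refine le_iSup₂_of_le
        (OrderDual.toDual (OrderDual.ofDual F ∪ OrderDual.ofDual H)) ⟨?_, ?_⟩ ?_
      · exact U.lower (show OrderDual.ofDual F ⊆ _ from Finset.subset_union_left) hF
      · exact W.lower (show OrderDual.ofDual H ⊆ _ from Finset.subset_union_right) hH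
      · refine le_iInf₂ fun a ha => ?_
        rcases Finset.mem_union.1 ha with h | h
        · exact inf_le_left.trans (iInf₂_le a h)
        · exact inf_le_right.trans (iInf₂_le a h)
  map_top' := by
    refine top_le_iff.1 (le_iSup₂_of_le (OrderDual.toDual ∅) (LowerSet.mem_top) ?_)
    simp
  map_sSup' S := by
    apply le_antisymm
    · refine iSup₂_le fun F hF => ?_
      obtain ⟨U, hU, hFU⟩ := LowerSet.mem_sSup_iff.1 hF
      exact le_trans (le_iSup₂_of_le F hFU le_rfl) (le_sSup (Set.mem_image_of_mem _ hU))
    · refine sSup_le ?_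
      rintro _ ⟨U, hU, rfl⟩
      refine iSup₂_le fun F hF => ?_
      exact le_iSup₂_of_le F (LowerSet.mem_sSup_iff.2 ⟨U, hU, hF⟩) le_rfl

theorem lift_gen (f : α → M) (a : α) : lift f (gen a) = f a := by
  apply le_antisymm
  · refine iSup₂_le fun F hF => ?_
    have h : ({a} : Finset α) ⊆ OrderDual.ofDual F := hF
    exact iInf₂_le a (h (Finset.mem_singleton_self a))
  · refine le_iSup₂_of_le (OrderDual.toDual {a}) (LowerSet.mem_Iic_iff.2 le_rfl) ?_
    simp

end FreeFrame

/-- The quotient of a frame `L` by relations `u ≤ v` (one for each pair with `r u v`), realised as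
the sublocale of `r`-saturated elements of `L`. -/
def saturated {L : Type u} [Order.Frame L] (r : L → L → Prop) : Sublocale L where
  carrier := {s | ∀ u v, r u v → ∀ c, c ⊓ v ≤ s → c ⊓ u ≤ s}
  sInf_mem' S hS u v h c hc :=
    le_sInf fun s hs => hS hs u v h c (hc.trans (sInf_le hs))
  himp_mem' a s hs u v h c hc := by
    rw [le_himp_iff] at hc ⊢
    have := hs u v h (c ⊓ a) (by rwa [inf_right_comm])
    rwa [inf_right_comm] at this

/-- The frame with generators `α` and relations `u ≤ v` for `r u v`. -/
abbrev PresentedFrame {α : Type u} (r : FreeFrame α → FreeFrame α → Prop) : Type u :=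
  ↥(saturated r)

namespace PresentedFrame

variable {α : Type u} {r : FreeFrame α → FreeFrame α → Prop} {M : Type v} [Order.Frame M]

/-- The quotient map from the free frame. -/
def proj (r : FreeFrame α → FreeFrame α → Prop) : FrameHom (FreeFrame α) (PresentedFrame r) :=
  (saturated r).restrict

/-- A generator, as an element of the presented frame. -/
def gen (r : FreeFrame α → FreeFrame α → Prop) (a : α) : PresentedFrame r :=
  proj r (FreeFrame.gen a)

theorem proj_le_proj {U W : FreeFrame α} (h : r U W) : proj r U ≤ proj r W := by
  refine (saturated r).giRestrict.gc.l_le ?_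
  have h1 : W ≤ (proj r W).1 := (saturated r).giRestrict.gc.le_u_l W
  simpa using (proj r W).2 U W h ⊤ (by simpa using h1)

/-- A frame homomorphism that respects the relations does not see the difference between an
element and its saturation. -/
theorem map_proj (f : FrameHom (FreeFrame α) M) (hf : ∀ U W, r U W → f U ≤ f W)
    (U : FreeFrame α) : f (proj r U).1 = f U := by
  apply le_antisymm
  · let s : FreeFrame α := sSup {W | f W ≤ f U}
    have hs : ∀ W, W ≤ s ↔ f W ≤ f U := fun W => by
      refine ⟨fun h => (OrderHomClass.mono f h).trans ?_, fun h => le_sSup h⟩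
      rw [map_sSup]
      exact sSup_le (by rintro _ ⟨Z, hZ, rfl⟩; exact hZ)
    have hmem : s ∈ saturated r := fun A B hAB c hc => by
      rw [hs] at hc ⊢
      rw [map_inf] at hc ⊢
      exact (inf_le_inf_left _ (hf A B hAB)).trans hc
    have h2 : proj r U ≤ ⟨s, hmem⟩ := (saturated r).giRestrict.gc.l_le ((hs U).2 le_rfl)
    exact (hs _).1 h2
  · exact OrderHomClass.mono f ((saturated r).giRestrict.gc.le_u_l U)

/-- The frame homomorphism out of a presented frame given by a map on the generators that
respects the relations. -/
def lift (f : α → M) (hf : ∀ U W, r U W → FreeFrame.lift f U ≤ FreeFrame.lift f W) :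
    FrameHom (PresentedFrame r) M where
  toFun U := FreeFrame.lift f U.1
  map_inf' U W := map_inf (FreeFrame.lift f) U.1 W.1
  map_top' := map_top (FreeFrame.lift f)
  map_sSup' S := by
    have h : sSup S = proj r (sSup (Subtype.val '' S)) := by
      have := (saturated r).giRestrict.l_sSup_u_image S
      exact this.symm
    rw [h, map_proj (FreeFrame.lift f) hf, map_sSup, Set.image_image]

theorem lift_gen (f : α → M) (hf : ∀ U W, r U W → FreeFrame.lift f U ≤ FreeFrame.lift f W)
    (a : α) : lift f hf (gen r a) = f a :=
  (map_proj (FreeFrame.lift f) hf _).trans (FreeFrame.lift_gen f a)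

end PresentedFrame

/-! ### Geometric theories -/

/-- A many-sorted relational signature. A nullary relation symbol is a basic proposition. -/
structure GeomSignature where
  /-- the sorts -/
  Srt : Type u
  /-- the relation symbols -/
  Rel : Type v
  /-- the number of arguments -/
  arity : Rel → ℕ
  /-- the sorts of the arguments -/
  dom : (R : Rel) → Fin (arity R) → Srt

/-- Raw geometric formulae in `n` variables `0, …, n - 1`. The quantifier `ex X φ` binds the
variable `0` of `φ`, and the variable `i` of `ex X φ` is the variable `i + 1` of `φ`. -/
inductive GeomFormula (S : GeomSignature.{u, v}) : ℕ → Type (max u v (w + 1))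
  | rel {n : ℕ} (R : S.Rel) (t : Fin (S.arity R) → Fin n) : GeomFormula S n
  | eq {n : ℕ} (X : S.Srt) (i j : Fin n) : GeomFormula S n
  | top {n : ℕ} : GeomFormula S n
  | and {n : ℕ} (φ ψ : GeomFormula S n) : GeomFormula S n
  | or {n : ℕ} (ι : Type w) (φ : ι → GeomFormula S n) : GeomFormula S n
  | ex {n : ℕ} (X : S.Srt) (φ : GeomFormula S (n + 1)) : GeomFormula S n

namespace GeomFormula

variable {S : GeomSignature.{u, v}}

/-- `φ.WellSorted Γ`: the formula `φ` is well-formed when the variable `i` has sort `Γ i`. -/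
def WellSorted : {n : ℕ} → GeomFormula.{u, v, w} S n → (Fin n → S.Srt) → Prop
  | _, rel R t, Γ => ∀ i, Γ (t i) = S.dom R i
  | _, eq X i j, Γ => Γ i = X ∧ Γ j = X
  | _, top, _ => True
  | _, and φ ψ, Γ => φ.WellSorted Γ ∧ ψ.WellSorted Γ
  | _, or _ φ, Γ => ∀ i, (φ i).WellSorted Γ
  | _, ex X φ, Γ => φ.WellSorted (Fin.cons X Γ)

/-- Finite conjunctions. -/
def bigAnd {n : ℕ} : (k : ℕ) → (Fin k → GeomFormula.{u, v, w} S n) → GeomFormula.{u, v, w} S n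
  | 0, _ => top
  | k + 1, φ => and (φ 0) (bigAnd k fun i => φ i.succ)

theorem wellSorted_bigAnd {n : ℕ} {Γ : Fin n → S.Srt} :
    ∀ {k : ℕ} {φ : Fin k → GeomFormula.{u, v, w} S n}, (∀ i, (φ i).WellSorted Γ) →
      (bigAnd k φ).WellSorted Γ
  | 0, _, _ => trivial
  | _ + 1, _, h => ⟨h 0, wellSorted_bigAnd fun i => h i.succ⟩

end GeomFormula

/-- A sequent `φ ⊢_Γ ψ` of geometric formulae in a context of sorted variables. -/
structure GeomSequent (S : GeomSignature.{u, v}) where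
  /-- the number of variables in the context -/
  n : ℕ
  /-- the sorts of the variables -/
  ctx : Fin n → S.Srt
  /-- the left-hand side -/
  lhs : GeomFormula.{u, v, w} S n
  /-- the right-hand side -/
  rhs : GeomFormula.{u, v, w} S n
  lhs_wellSorted : lhs.WellSorted ctx
  rhs_wellSorted : rhs.WellSorted ctx

/-- A first-order geometric theory. -/
structure GeomTheory where
  /-- the signature -/
  sig : GeomSignature.{u, v}
  /-- the axioms -/
  axioms : Set (GeomSequent.{u, v, w} sig)

/-! ### The propositional theory `P[T]` and its classifying locale -/

/-- The basic propositions `[n ∼^X m]` and `[(n₁, …, n_k) ∈ R]` of `P[T]`. -/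
inductive Atom (S : GeomSignature.{u, v}) : Type (max u v)
  | sim (X : S.Srt) (n m : ℕ) : Atom S
  | rel (R : S.Rel) (a : Fin (S.arity R) → ℕ) : Atom S

/-- The propositional translation `φ_{n₁, …, n_k}` of a geometric formula, with the basic
propositions evaluated in a frame: equality becomes `∼` and `∃` becomes a join over `ℕ`. -/
def GeomFormula.interp {S : GeomSignature.{u, v}} {L : Type x} [Order.Frame L] (p : Atom S → L) :
    {n : ℕ} → GeomFormula.{u, v, w} S n → (Fin n → ℕ) → L
  | _, .rel R t, a => p (.rel R fun i => a (t i))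
  | _, .eq X i j, a => p (.sim X (a i) (a j))
  | _, .top, _ => ⊤
  | _, .and φ ψ, a => φ.interp p a ⊓ ψ.interp p a
  | _, .or _ φ, a => ⨆ i, (φ i).interp p a
  | _, .ex _ φ, a => ⨆ m : ℕ, φ.interp p (Fin.cons m a)

/-- The axioms of the propositional geometric theory `P[T]`, as relations `lhs ≤ rhs` between
elements of the free frame on the basic propositions. -/
inductive PropAxiom (T : GeomTheory.{u, v, w}) :
    FreeFrame (Atom T.sig) → FreeFrame (Atom T.sig) → Prop
  | symm (X : T.sig.Srt) (n m : ℕ) :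
      PropAxiom T (.gen (.sim X n m)) (.gen (.sim X m n))
  | trans (X : T.sig.Srt) (n m l : ℕ) :
      PropAxiom T (.gen (.sim X n m) ⊓ .gen (.sim X m l)) (.gen (.sim X n l))
  | rel_congr (R : T.sig.Rel) (n m : Fin (T.sig.arity R) → ℕ) :
      PropAxiom T (.gen (.rel R n) ⊓ ⨅ i, .gen (.sim (T.sig.dom R i) (n i) (m i)))
        (.gen (.rel R m))
  | rel_strict (R : T.sig.Rel) (n : Fin (T.sig.arity R) → ℕ) :
      PropAxiom T (.gen (.rel R n)) (⨅ i, .gen (.sim (T.sig.dom R i) (n i) (n i)))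
  | ax (σ : GeomSequent.{u, v, w} T.sig) (hσ : σ ∈ T.axioms) (n : Fin σ.n → ℕ) :
      PropAxiom T ((⨅ i, .gen (.sim (σ.ctx i) (n i) (n i))) ⊓ σ.lhs.interp FreeFrame.gen n)
        (σ.rhs.interp FreeFrame.gen n)

/-- The frame of opens of `G₀ᵀ`, the classifying locale of `P[T]`. -/
abbrev OpensG0 (T : GeomTheory.{u, v, w}) : Type (max u v) := PresentedFrame (PropAxiom T)

/-- A basic proposition as an open of the classifying locale of `P[T]`. -/
def GeomTheory.atom (T : GeomTheory.{u, v, w}) (g : Atom T.sig) : OpensG0 T :=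
  PresentedFrame.gen (PropAxiom T) g

/-! ### The theory `T_≅` of isomorphisms between models -/

/-- The two copies of `T` inside `T_≅`: the domain (`1`) and the codomain (`2`). -/
inductive Side : Type
  | one
  | two

/-- The relation symbols of `T_≅`: the copies `R₁`, `R₂` and the graphs `α^X`. -/
inductive IsoRel (S : GeomSignature.{u, v}) : Type (max u v)
  | copy (c : Side) (R : S.Rel) : IsoRel S
  | alpha (X : S.Srt) : IsoRel S

/-- The signature of `T_≅`. -/
abbrev GeomSignature.iso (S : GeomSignature.{u, v}) : GeomSignature.{u, max u v} where
  Srt := Side × S.Srt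
  Rel := IsoRel S
  arity
    | .copy _ R => S.arity R
    | .alpha _ => 2
  dom
    | .copy c R => fun i => (c, S.dom R i)
    | .alpha X => ![(.one, X), (.two, X)]

namespace GeomFormula

variable {S : GeomSignature.{u, v}}

/-- The copy of a formula of `T` on side `c`. -/
def copy (c : Side) : {n : ℕ} → GeomFormula.{u, v, w} S n → GeomFormula.{u, max u v, w} S.iso n
  | _, rel R t => rel (S := S.iso) (.copy c R) t
  | _, eq X i j => eq (S := S.iso) (c, X) i j
  | _, top => top
  | _, and φ ψ => and (φ.copy c) (ψ.copy c)
  | _, or ι φ => or ι fun i => (φ i).copy c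
  | _, ex X φ => ex (S := S.iso) (c, X) (φ.copy c)

theorem WellSorted.copy (c : Side) : ∀ {n : ℕ} {φ : GeomFormula.{u, v, w} S n} {Γ : Fin n → S.Srt},
    φ.WellSorted Γ → (φ.copy c).WellSorted (S := S.iso) fun i => (c, Γ i)
  | _, .rel _ _, _, h => fun i => congrArg (Prod.mk c) (h i)
  | _, .eq _ _ _, _, h => ⟨congrArg (Prod.mk c) h.1, congrArg (Prod.mk c) h.2⟩
  | _, .top, _, _ => trivial
  | _, .and _ _, _, h => ⟨WellSorted.copy c h.1, WellSorted.copy c h.2⟩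
  | _, .or _ _, _, h => fun i => WellSorted.copy c (h i)
  | _, .ex X φ, Γ, h => by
    have h1 := WellSorted.copy c (φ := φ) h
    have h2 := Fin.comp_cons (fun Y : S.Srt => ((c, Y) : S.iso.Srt)) X Γ
    change (φ.copy c).WellSorted (S := S.iso) (Fin.cons (c, X) fun i => (c, Γ i))
    exact Eq.mp (congrArg (fun Δ => (φ.copy c).WellSorted (S := S.iso) Δ) h2) h1

/-- The formula `(i, j) ∈ α^X`. -/
def alpha {n : ℕ} (X : S.Srt) (i j : Fin n) : GeomFormula.{u, max u v, w} S.iso n :=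
  rel (S := S.iso) (.alpha X) ![i, j]

theorem wellSorted_alpha {n : ℕ} {Γ : Fin n → S.iso.Srt} {X : S.Srt} {i j : Fin n}
    (hi : Γ i = (Side.one, X)) (hj : Γ j = (Side.two, X)) :
    (alpha.{u, v, w} X i j).WellSorted Γ := by
  intro k
  change Fin 2 at k
  fin_cases k
  · exact hi
  · exact hj

end GeomFormula

namespace GeomSequent

open GeomFormula

variable {S : GeomSignature.{u, v}}

/-- The copy of a sequent of `T` on side `c`. -/
def copy (c : Side) (σ : GeomSequent.{u, v, w} S) : GeomSequent.{u, max u v, w} S.iso where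
  n := σ.n
  ctx i := (c, σ.ctx i)
  lhs := σ.lhs.copy c
  rhs := σ.rhs.copy c
  lhs_wellSorted := σ.lhs_wellSorted.copy c
  rhs_wellSorted := σ.rhs_wellSorted.copy c

/-- `(x,y) ∈ α ∧ (x',y') ∈ α ∧ x = x' ⊢ (x,y) ∈ α ∧ (x',y') ∈ α ∧ y = y'`,
for the variables `x, x' : X₁` (`0` and `1`) and `y, y' : X₂` (`2` and `3`). -/
def alphaFun (X : S.Srt) : GeomSequent.{u, max u v, w} S.iso where
  n := 4
  ctx := ![(.one, X), (.one, X), (.two, X), (.two, X)]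
  lhs := and (alpha X 0 2) (and (alpha X 1 3) (eq (S := S.iso) (.one, X) 0 1))
  rhs := and (alpha X 0 2) (and (alpha X 1 3) (eq (S := S.iso) (.two, X) 2 3))
  lhs_wellSorted := ⟨wellSorted_alpha rfl rfl, wellSorted_alpha rfl rfl, rfl, rfl⟩
  rhs_wellSorted := ⟨wellSorted_alpha rfl rfl, wellSorted_alpha rfl rfl, rfl, rfl⟩

/-- The sequent converse to `alphaFun`. -/
def alphaInj (X : S.Srt) : GeomSequent.{u, max u v, w} S.iso where
  n := (alphaFun.{u, v, w} X).n
  ctx := (alphaFun.{u, v, w} X).ctx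
  lhs := (alphaFun X).rhs
  rhs := (alphaFun X).lhs
  lhs_wellSorted := (alphaFun X).rhs_wellSorted
  rhs_wellSorted := (alphaFun X).lhs_wellSorted

/-- `⊢_{y : X₂} ∃ x : X₁, (x, y) ∈ α^X`. -/
def alphaSurj (X : S.Srt) : GeomSequent.{u, max u v, w} S.iso where
  n := 1
  ctx := ![(.two, X)]
  lhs := top
  rhs := ex (S := S.iso) (.one, X) (alpha X 0 1)
  lhs_wellSorted := trivial
  rhs_wellSorted := wellSorted_alpha rfl rfl

/-- `⊢_{x : X₁} ∃ y : X₂, (x, y) ∈ α^X`. -/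
def alphaTotal (X : S.Srt) : GeomSequent.{u, max u v, w} S.iso where
  n := 1
  ctx := ![(.one, X)]
  lhs := top
  rhs := ex (S := S.iso) (.two, X) (alpha X 1 0)
  lhs_wellSorted := trivial
  rhs_wellSorted := wellSorted_alpha rfl rfl

/-- `⋀ᵢ (xᵢ, yᵢ) ∈ α ∧ (x₁, …, x_k) ∈ R₁ ⊢ ⋀ᵢ (xᵢ, yᵢ) ∈ α ∧ (y₁, …, y_k) ∈ R₂`. -/
def relFwd (R : S.Rel) : GeomSequent.{u, max u v, w} S.iso where
  n := S.arity R + S.arity R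
  ctx := Fin.append (fun i => (.one, S.dom R i)) (fun i => (.two, S.dom R i))
  lhs := and
    (bigAnd (S.arity R) fun i => alpha (S.dom R i) (Fin.castAdd _ i) (Fin.natAdd _ i))
    (rel (S := S.iso) (.copy .one R) fun i => Fin.castAdd _ i)
  rhs := and
    (bigAnd (S.arity R) fun i => alpha (S.dom R i) (Fin.castAdd _ i) (Fin.natAdd _ i))
    (rel (S := S.iso) (.copy .two R) fun i => Fin.natAdd _ i)
  lhs_wellSorted :=
    ⟨wellSorted_bigAnd fun i => wellSorted_alpha (Fin.append_left _ _ i) (Fin.append_right _ _ i),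
      fun i => Fin.append_left _ _ i⟩
  rhs_wellSorted :=
    ⟨wellSorted_bigAnd fun i => wellSorted_alpha (Fin.append_left _ _ i) (Fin.append_right _ _ i),
      fun i => Fin.append_right _ _ i⟩

/-- The sequent converse to `relFwd`. -/
def relBwd (R : S.Rel) : GeomSequent.{u, max u v, w} S.iso where
  n := (relFwd.{u, v, w} R).n
  ctx := (relFwd.{u, v, w} R).ctx
  lhs := (relFwd R).rhs
  rhs := (relFwd R).lhs
  lhs_wellSorted := (relFwd R).rhs_wellSorted
  rhs_wellSorted := (relFwd R).lhs_wellSorted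

end GeomSequent

/-- The axioms of `T_≅`. -/
inductive IsoAxiom (T : GeomTheory.{u, v, w}) : GeomSequent.{u, max u v, w} T.sig.iso → Prop
  | copy (c : Side) (σ : GeomSequent.{u, v, w} T.sig) (hσ : σ ∈ T.axioms) : IsoAxiom T (σ.copy c)
  | alphaFun (X : T.sig.Srt) : IsoAxiom T (.alphaFun X)
  | alphaInj (X : T.sig.Srt) : IsoAxiom T (.alphaInj X)
  | alphaSurj (X : T.sig.Srt) : IsoAxiom T (.alphaSurj X)
  | alphaTotal (X : T.sig.Srt) : IsoAxiom T (.alphaTotal X)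
  | relFwd (R : T.sig.Rel) : IsoAxiom T (.relFwd R)
  | relBwd (R : T.sig.Rel) : IsoAxiom T (.relBwd R)

/-- The theory `T_≅` of isomorphisms between models of `T`. -/
abbrev GeomTheory.iso (T : GeomTheory.{u, v, w}) : GeomTheory.{u, max u v, w} where
  sig := T.sig.iso
  axioms := {σ | IsoAxiom T σ}

/-- The frame of opens of `G₁ᵀ`, the classifying locale of `P[T_≅]`. -/
abbrev OpensG1 (T : GeomTheory.{u, v, w}) : Type (max u v) := OpensG0 T.iso

namespace Atom

variable {S : GeomSignature.{u, v}}

/-- The copy of a basic proposition on side `c`: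
`[n ∼^{X_c} m]` for `[n ∼^X m]`, and `[(n₁, …, n_k) ∈ R_c]` for `[(n₁, …, n_k) ∈ R]`. -/
def copy (c : Side) : Atom S → Atom S.iso
  | sim X n m => sim (S := S.iso) (c, X) n m
  | rel R a => rel (S := S.iso) (.copy c R) a

/-- The basic proposition `[α^X(n) = m]`. -/
def alpha (X : S.Srt) (n m : ℕ) : Atom S.iso := rel (S := S.iso) (.alpha X) ![n, m]

end Atom

/-! ### The source map -/

theorem GeomFormula.map_interp {S : GeomSignature.{u, v}} {α : Type x} {L : Type*}
    [Order.Frame L] (p : Atom S → FreeFrame α) (f : FrameHom (FreeFrame α) L) :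
    ∀ {n : ℕ} (φ : GeomFormula.{u, v, w} S n) (a : Fin n → ℕ),
      f (φ.interp p a) = φ.interp (fun g => f (p g)) a
  | _, .rel _ _, _ => rfl
  | _, .eq _ _ _, _ => rfl
  | _, .top, _ => map_top f
  | _, .and φ ψ, a => by simp only [interp, map_inf, map_interp p f]
  | _, .or ι φ, a => by simp only [interp, map_iSup, map_interp p f]
  | _, .ex X φ, a => by simp only [interp, map_iSup, map_interp p f]

theorem GeomFormula.interp_copy {S : GeomSignature.{u, v}} {L : Type x} [Order.Frame L]
    (p : Atom S.iso → L) (c : Side) :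
    ∀ {n : ℕ} (φ : GeomFormula.{u, v, w} S n) (a : Fin n → ℕ),
      (φ.copy c).interp p a = φ.interp (fun g => p (g.copy c)) a
  | _, .rel _ _, _ => rfl
  | _, .eq _ _ _, _ => rfl
  | _, .top, _ => rfl
  | _, .and φ ψ, a => by simp only [interp, copy, interp_copy p c]
  | _, .or ι φ, a => by simp only [interp, copy, interp_copy p c]
  | _, .ex X φ, a => by simp only [interp, copy, interp_copy p c]

theorem FrameHom.map_iInf_fin {L M : Type*} [CompleteLattice L] [CompleteLattice M]
    (f : FrameHom L M) {k : ℕ} (g : Fin k → L) : f (⨅ i, g i) = ⨅ i, f (g i) := by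
  rw [← Finset.inf_univ_eq_iInf, ← Finset.inf_univ_eq_iInf, map_finset_inf]
  rfl

/-- The axioms of `P[T]` hold for the copy of the basic propositions on side `c` in the classifying
locale of `P[T_≅]`. -/
theorem copy_respects (T : GeomTheory.{u, v, w}) (c : Side) (U W : FreeFrame (Atom T.sig))
    (h : PropAxiom T U W) :
    FreeFrame.lift (fun g : Atom T.sig => T.iso.atom (g.copy c)) U ≤
      FreeFrame.lift (fun g : Atom T.sig => T.iso.atom (g.copy c)) W := by
  have key : ∀ {A B}, PropAxiom T.iso A B →
      PresentedFrame.proj (PropAxiom T.iso) A ≤ PresentedFrame.proj (PropAxiom T.iso) B :=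
    fun h => PresentedFrame.proj_le_proj h
  cases h with
  | symm X n m =>
    simp only [FreeFrame.lift_gen]
    exact key (.symm (T := T.iso) (c, X) n m)
  | trans X n m l =>
    have := key (.trans (T := T.iso) (c, X) n m l)
    rw [map_inf] at this
    simp only [map_inf, FreeFrame.lift_gen]
    exact this
  | rel_congr R n m =>
    have := key (.rel_congr (T := T.iso) (.copy c R) n m)
    rw [map_inf, FrameHom.map_iInf_fin] at this
    simp only [map_inf, FrameHom.map_iInf_fin, FreeFrame.lift_gen]
    exact this
  | rel_strict R n =>
    have := key (.rel_strict (T := T.iso) (.copy c R) n)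
    rw [FrameHom.map_iInf_fin] at this
    simp only [FrameHom.map_iInf_fin, FreeFrame.lift_gen]
    exact this
  | ax σ hσ n =>
    have h1 : ∀ φ : GeomFormula.{u, v, w} T.sig σ.n,
        FreeFrame.lift (fun g : Atom T.sig => T.iso.atom (g.copy c))
          (φ.interp FreeFrame.gen n) =
        PresentedFrame.proj (PropAxiom T.iso) ((φ.copy c).interp FreeFrame.gen n) := fun φ => by
      refine (GeomFormula.map_interp _ _ φ n).trans ?_
      refine Eq.trans ?_ (GeomFormula.map_interp FreeFrame.gen _ (φ.copy c) n).symm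
      refine Eq.trans ?_ (GeomFormula.interp_copy T.iso.atom c φ n).symm
      simp only [FreeFrame.lift_gen]
    have := key (.ax (T := T.iso) (σ.copy c) (.copy c σ hσ) n)
    rw [map_inf, FrameHom.map_iInf_fin] at this
    rw [map_inf, FrameHom.map_iInf_fin, h1, h1]
    simp only [FreeFrame.lift_gen]
    exact this

/-- The frame map `s^*` of the source map `s : G₁ᵀ → G₀ᵀ`, which sends every basic proposition to
its copy on side `1`. -/
noncomputable def sourceStar (T : GeomTheory.{u, v, w}) : FrameHom (OpensG0 T) (OpensG1 T) :=
  PresentedFrame.lift (fun g => T.iso.atom (g.copy .one)) (copy_respects T .one)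

theorem sourceStar_atom (T : GeomTheory.{u, v, w}) (g : Atom T.sig) :
    sourceStar T (T.atom g) = T.iso.atom (g.copy .one) :=
  PresentedFrame.lift_gen _ _ g

/-! ### The formula for the left adjoint -/

namespace Atom

variable {S : GeomSignature.{u, v}}

/-- The variables that occur in a basic proposition: pairs of a natural number and a sort. -/
def vars : Atom S → Set (ℕ × S.Srt)
  | sim X n m => {(n, X), (m, X)}
  | rel R a => Set.range fun i => (a i, S.dom R i)

/-- Replace each variable of a basic proposition by its value under `y`. -/
def subst : (g : Atom S) → (g.vars → ℕ) → Atom S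
  | sim X n m, y => sim X (y ⟨(n, X), Or.inl rfl⟩) (y ⟨(m, X), Or.inr rfl⟩)
  | rel R a, y => rel R fun i => y ⟨(a i, S.dom R i), i, rfl⟩

end Atom

/-- The set `V` of variables that occur in the atoms `B j` or as one of the values `d k`, which
has sort `X k`. -/
def codVars {S : GeomSignature.{u, v}} {J K : Type*} (B : J → Atom S) (X : K → S.Srt)
    (d : K → ℕ) : Set (ℕ × S.Srt) :=
  (⋃ j, (B j).vars) ∪ Set.range fun k => (d k, X k)

/-- The projection of `y ∈ ℕ^V` to the variables of the atom `B j`. -/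
def projAtom {S : GeomSignature.{u, v}} {J K : Type*} (B : J → Atom S) (X : K → S.Srt)
    (d : K → ℕ) (j : J) (y : codVars B X d → ℕ) : (B j).vars → ℕ :=
  fun p => y ⟨p.1, Or.inl (Set.mem_iUnion.2 ⟨j, p.2⟩)⟩

/-- The projection of `y ∈ ℕ^V` to the variable `(d k, X k)`. -/
def projVal {S : GeomSignature.{u, v}} {J K : Type*} (B : J → Atom S) (X : K → S.Srt)
    (d : K → ℕ) (k : K) (y : codVars B X d → ℕ) : ℕ :=
  y ⟨(d k, X k), Or.inr ⟨k, rfl⟩⟩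

/-- The basic open
`⋀_i [a^i ∈ R^i_1] ∧ ⋀_j [b^j ∈ R^j_2] ∧ ⋀_k [α^{X^k}(c^k) = d^k]` of `G₁ᵀ`. Here `A i` is
`[a^i ∈ R^i]` and `B j` is `[b^j ∈ R^j]`, where `R^i` and `R^j` may also be equality. -/
noncomputable def basicOpen (T : GeomTheory.{u, v, w}) {I J K : Type*} (A : I → Atom T.sig)
    (B : J → Atom T.sig) (X : K → T.sig.Srt) (c d : K → ℕ) : OpensG1 T :=
  (⨅ i, T.iso.atom ((A i).copy .one)) ⊓ (⨅ j, T.iso.atom ((B j).copy .two)) ⊓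
    ⨅ k, T.iso.atom (.alpha (X k) (c k) (d k))

/-- The open
`⋀_i [a^i ∈ R^i] ∧ ⋁_{y ∈ ℕ^V} (⋀_j [π^j(y) ∈ R^j] ∧ ⋀_k [c^k ∼^{X^k} π^k(y)])` of `G₀ᵀ`. -/
noncomputable def imageOpen (T : GeomTheory.{u, v, w}) {I J K : Type*} (A : I → Atom T.sig)
    (B : J → Atom T.sig) (X : K → T.sig.Srt) (c d : K → ℕ) : OpensG0 T :=
  (⨅ i, T.atom (A i)) ⊓ ⨆ y : codVars B X d → ℕ,
    (⨅ j, T.atom ((B j).subst (projAtom B X d j y))) ⊓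
      ⨅ k, T.atom (.sim (X k) (c k) (projVal B X d k y))

/-! A point of `G₁ᵀ` is an enumerated model `M`, an enumerated model `N` and an isomorphism `α : M ≅
N`. Transporting along `α`, one may take `N = M` and `α` the identity. What remains over `M` is a
second partial enumeration of `M`, whose finite pieces are the namings: finite partial maps `p` from
second numbers to first numbers. For fixed `p` each basic proposition of `T_≅` has a value `p.eval`
in `OpensG0 T`, with `⊥` wherever an atom uses an unnamed number, and `α` becomes `∼`. The left
adjoint sends `U` to the join over all `p` of "the values of `p` exist and `U` holds at `p`".

The main point is that this join respects the axioms of `P[T_≅]`. At a fixed `p` it need not: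
existential axioms on side 2 and totality of `α` may require an element that `p` does not name.
Since `p` is finite, a fresh number can always name it. The proof therefore compares values with
families indexed by namings that are local for such extensions (`IsLocal.interpVal_le`,
`IsLocal.lift_le`, `isLocal_himp`, `preShriek_inf_le`).

The counit holds because `p.eval` does not change side-1 atoms. For the unit, surjectivity of `α`
covers a finite meet of atoms by opens on which a naming describes `α` on all its side-2 variables;
there the isomorphism axioms move each atom to side 1. In the explicit formula, a naming defined on
`V` restricts to some `y`, and any other contributes `⊥`. Uniqueness holds because every open is a
join of basic opens. -/

theorem FrameHom.map_iInf_finite {L M : Type*} [CompleteLattice L] [CompleteLattice M]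
    (f : FrameHom L M) {ι : Type*} [Finite ι] (g : ι → L) : f (⨅ i, g i) = ⨅ i, f (g i) := by
  cases nonempty_fintype ι
  rw [← Finset.inf_univ_eq_iInf, ← Finset.inf_univ_eq_iInf, map_finset_inf]
  rfl

/-! ### Elements of free and presented frames as joins of finite meets of generators. -/

namespace FreeFrame

variable {α : Type u} {M : Type v} [Order.Frame M] {N : Type w} [Order.Frame N]

theorem map_lift (f : FrameHom M N) (g : α → M) (U : FreeFrame α) :
    f (lift g U) = lift (fun a => f (g a)) U := by
  change f (⨆ F ∈ U, ⨅ a ∈ OrderDual.ofDual F, g a) = ⨆ F ∈ U, ⨅ a ∈ OrderDual.ofDual F, f (g a)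
  simp only [map_iSup]
  refine iSup_congr fun F => iSup_congr fun _ => ?_
  rw [← Finset.inf_eq_iInf, ← Finset.inf_eq_iInf, map_finset_inf]
  rfl

theorem lift_gen_self (U : FreeFrame α) : lift gen U = U := by
  apply le_antisymm
  · refine iSup₂_le fun F hF G hG => U.lower (show G ≤ F from fun a ha => ?_) hF
    have h : G ∈ gen a := (iInf₂_le (f := fun a (_ : a ∈ OrderDual.ofDual F) => gen a) a ha) hG
    exact h (Finset.mem_singleton_self a)
  · intro F hF
    have h : LowerSet.Iic F ≤ lift gen U :=
      le_iSup₂_of_le F hF <| le_iInf₂ fun a ha => LowerSet.Iic_le.2 <|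
        Finset.singleton_subset_iff.2 ha
    exact h (LowerSet.mem_Iic_iff.2 le_rfl)

theorem lift_mono {f g : α → M} (h : ∀ a, f a ≤ g a) (U : FreeFrame α) : lift f U ≤ lift g U :=
  iSup₂_mono fun _ _ => iInf₂_mono fun a _ => h a

end FreeFrame

namespace PresentedFrame

variable {α : Type u} (r : FreeFrame α → FreeFrame α → Prop)

theorem proj_eq_lift (U : FreeFrame α) : proj r U = FreeFrame.lift (gen r) U := by
  conv_lhs => rw [← FreeFrame.lift_gen_self U, FreeFrame.map_lift]
  rfl

theorem proj_coe (b : PresentedFrame r) : proj r b.1 = b :=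
  (saturated r).giRestrict.l_u_eq b

end PresentedFrame

namespace GeomFormula

variable {S : GeomSignature.{u, v}} {L : Type x} [Order.Frame L]

theorem interp_mono {p q : Atom S → L} (h : ∀ g, p g ≤ q g) :
    ∀ {n : ℕ} (φ : GeomFormula.{u, v, w} S n) (a : Fin n → ℕ), φ.interp p a ≤ φ.interp q a
  | _, .rel _ _, _ => h _
  | _, .eq _ _ _, _ => h _
  | _, .top, _ => le_rfl
  | _, .and φ ψ, a => inf_le_inf (interp_mono h φ a) (interp_mono h ψ a)
  | _, .or _ φ, a => iSup_mono fun i => interp_mono h (φ i) a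
  | _, .ex _ φ, a => iSup_mono fun m => interp_mono h φ (Fin.cons m a)

theorem interp_bigAnd (p : Atom S → L) {n : ℕ} (a : Fin n → ℕ) :
    ∀ {k : ℕ} (φ : Fin k → GeomFormula.{u, v, w} S n),
      (bigAnd k φ).interp p a = ⨅ i, (φ i).interp p a
  | 0, _ => (iInf_of_empty _).symm
  | k + 1, φ => by
    simp only [bigAnd, interp, interp_bigAnd p a fun i => φ i.succ]
    refine le_antisymm (le_iInf (Fin.cases inf_le_left fun i => ?_))
      (le_inf (iInf_le _ 0) (le_iInf fun i => iInf_le _ i.succ))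
    exact inf_le_right.trans (iInf_le _ i)

theorem lift_interp {α : Type*} (p : Atom S → FreeFrame α) (f : α → L) {n : ℕ}
    (φ : GeomFormula.{u, v, w} S n) (a : Fin n → ℕ) :
    FreeFrame.lift f (φ.interp p a) = φ.interp (fun g => FreeFrame.lift f (p g)) a :=
  map_interp _ _ _ _

end GeomFormula

/-! ### The axioms of `P[T]` as inequalities, extended to undefined numbers. -/

namespace GeomTheory

variable (T : GeomTheory.{u, v, w})

theorem proj_interp {n : ℕ} (φ : GeomFormula.{u, v, w} T.sig n) (a : Fin n → ℕ) :
    PresentedFrame.proj (PropAxiom T) (φ.interp FreeFrame.gen a) = φ.interp T.atom a :=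
  GeomFormula.map_interp _ _ _ _

theorem atom_symm (X : T.sig.Srt) (n m : ℕ) : T.atom (.sim X n m) ≤ T.atom (.sim X m n) :=
  PresentedFrame.proj_le_proj (.symm X n m)

theorem atom_trans (X : T.sig.Srt) (n m l : ℕ) :
    T.atom (.sim X n m) ⊓ T.atom (.sim X m l) ≤ T.atom (.sim X n l) := by
  have := PresentedFrame.proj_le_proj (PropAxiom.trans (T := T) X n m l)
  rwa [map_inf] at this

theorem atom_rel_congr (R : T.sig.Rel) (n m : Fin (T.sig.arity R) → ℕ) :
    T.atom (.rel R n) ⊓ ⨅ i, T.atom (.sim (T.sig.dom R i) (n i) (m i)) ≤ T.atom (.rel R m) := by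
  have := PresentedFrame.proj_le_proj (PropAxiom.rel_congr (T := T) R n m)
  rwa [map_inf, FrameHom.map_iInf_fin] at this

theorem atom_rel_strict (R : T.sig.Rel) (n : Fin (T.sig.arity R) → ℕ) (i : Fin (T.sig.arity R)) :
    T.atom (.rel R n) ≤ T.atom (.sim (T.sig.dom R i) (n i) (n i)) := by
  have := PresentedFrame.proj_le_proj (PropAxiom.rel_strict (T := T) R n)
  rw [FrameHom.map_iInf_fin] at this
  exact this.trans (iInf_le _ i)

theorem atom_ax (σ : GeomSequent.{u, v, w} T.sig) (hσ : σ ∈ T.axioms) (n : Fin σ.n → ℕ) :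
    (⨅ i, T.atom (.sim (σ.ctx i) (n i) (n i))) ⊓ σ.lhs.interp T.atom n ≤
      σ.rhs.interp T.atom n := by
  have := PresentedFrame.proj_le_proj (PropAxiom.ax (T := T) σ hσ n)
  rwa [map_inf, FrameHom.map_iInf_fin, proj_interp, proj_interp] at this

theorem atom_sim_left (X : T.sig.Srt) (n m : ℕ) : T.atom (.sim X n m) ≤ T.atom (.sim X n n) :=
  (le_inf le_rfl (T.atom_symm X n m)).trans (T.atom_trans X n m n)

theorem atom_sim_right (X : T.sig.Srt) (n m : ℕ) : T.atom (.sim X n m) ≤ T.atom (.sim X m m) :=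
  (T.atom_symm X n m).trans (T.atom_sim_left X m n)

/-- `[o ∼^X o']` for possibly undefined numbers `o` and `o'`; it is `⊥` if one is undefined. -/
noncomputable def simVal (X : T.sig.Srt) (o o' : Option ℕ) : OpensG0 T :=
  ⨆ (n : ℕ) (m : ℕ) (_ : o = some n) (_ : o' = some m), T.atom (.sim X n m)

/-- `[o ∈ R]` for a tuple `o` of possibly undefined numbers; it is `⊥` if one is undefined. -/
noncomputable def relVal (R : T.sig.Rel) (o : Fin (T.sig.arity R) → Option ℕ) : OpensG0 T :=
  ⨆ (n : Fin (T.sig.arity R) → ℕ) (_ : ∀ i, o i = some (n i)), T.atom (.rel R n)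

variable {T}

theorem simVal_le {X : T.sig.Srt} {o o' : Option ℕ} {l : OpensG0 T}
    (h : ∀ n m, o = some n → o' = some m → T.atom (.sim X n m) ≤ l) : T.simVal X o o' ≤ l :=
  iSup_le fun n => iSup_le fun m => iSup_le fun hn => iSup_le fun hm => h n m hn hm

theorem relVal_le {R : T.sig.Rel} {o : Fin (T.sig.arity R) → Option ℕ} {l : OpensG0 T}
    (h : ∀ n : Fin (T.sig.arity R) → ℕ, (∀ i, o i = some (n i)) → T.atom (.rel R n) ≤ l) :
    T.relVal R o ≤ l :=
  iSup₂_le h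

theorem le_simVal {X : T.sig.Srt} {o o' : Option ℕ} {n m : ℕ} (hn : o = some n)
    (hm : o' = some m) : T.atom (.sim X n m) ≤ T.simVal X o o' :=
  le_iSup_of_le n <| le_iSup_of_le m <| le_iSup_of_le hn <| le_iSup_of_le hm le_rfl

theorem le_relVal {R : T.sig.Rel} {o : Fin (T.sig.arity R) → Option ℕ}
    {n : Fin (T.sig.arity R) → ℕ} (h : ∀ i, o i = some (n i)) :
    T.atom (.rel R n) ≤ T.relVal R o :=
  le_iSup₂_of_le n h le_rfl

@[simp]
theorem simVal_some (X : T.sig.Srt) (n m : ℕ) :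
    T.simVal X (some n) (some m) = T.atom (.sim X n m) := by
  refine le_antisymm (simVal_le fun n' m' hn hm => ?_) (le_simVal rfl rfl)
  cases hn
  cases hm
  exact le_rfl

@[simp]
theorem relVal_some (R : T.sig.Rel) (n : Fin (T.sig.arity R) → ℕ) :
    T.relVal R (fun i => some (n i)) = T.atom (.rel R n) := by
  refine le_antisymm (relVal_le fun m hm => ?_) (le_relVal fun _ => rfl)
  rw [funext fun i => Option.some.inj (hm i)]

theorem simVal_mono {X : T.sig.Srt} {o o' r r' : Option ℕ} (h : ∀ k, o = some k → r = some k)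
    (h' : ∀ k, o' = some k → r' = some k) : T.simVal X o o' ≤ T.simVal X r r' :=
  simVal_le fun _ _ hn hm => le_simVal (h _ hn) (h' _ hm)

theorem relVal_mono {R : T.sig.Rel} {o r : Fin (T.sig.arity R) → Option ℕ}
    (h : ∀ i k, o i = some k → r i = some k) : T.relVal R o ≤ T.relVal R r :=
  relVal_le fun _ hn => le_relVal fun i => h i _ (hn i)

theorem simVal_symm (X : T.sig.Srt) (o o' : Option ℕ) : T.simVal X o o' ≤ T.simVal X o' o :=
  simVal_le fun n m hn hm => (T.atom_symm X n m).trans (le_simVal hm hn)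

theorem simVal_trans (X : T.sig.Srt) (o₁ o₂ o₃ : Option ℕ) :
    T.simVal X o₁ o₂ ⊓ T.simVal X o₂ o₃ ≤ T.simVal X o₁ o₃ := by
  -- Moving one factor across `⇨` leaves a single `simVal` on the left, so that `simVal_le` can
  -- unpack it.
  rw [← le_himp_iff]
  refine simVal_le fun n m hn hm => ?_
  rw [le_himp_iff', ← le_himp_iff]
  refine simVal_le fun m' l hm' hl => ?_
  rw [le_himp_iff, inf_comm]
  obtain rfl : m = m' := Option.some.inj (hm.symm.trans hm')
  exact (T.atom_trans X n m l).trans (le_simVal hn hl)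

theorem simVal_left (X : T.sig.Srt) (o o' : Option ℕ) : T.simVal X o o' ≤ T.simVal X o o :=
  (le_inf le_rfl (simVal_symm X o o')).trans (simVal_trans X o o' o)

theorem simVal_right (X : T.sig.Srt) (o o' : Option ℕ) : T.simVal X o o' ≤ T.simVal X o' o' :=
  (simVal_symm X o o').trans (simVal_left X o' o)

theorem simVal_none_right (X : T.sig.Srt) (o : Option ℕ) : T.simVal X o none = ⊥ :=
  le_bot_iff.1 (simVal_le fun _ _ _ h => by cases h)

theorem relVal_strict (R : T.sig.Rel) (o : Fin (T.sig.arity R) → Option ℕ)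
    (i : Fin (T.sig.arity R)) : T.relVal R o ≤ T.simVal (T.sig.dom R i) (o i) (o i) :=
  relVal_le fun n hn => (T.atom_rel_strict R n i).trans (le_simVal (hn i) (hn i))

/-- One undefined `o' i` makes the whole meet `⊥`, so only the case where all are defined needs an
argument. -/
theorem iInf_simVal_le {ι : Type*} {X : ι → T.sig.Srt} {o o' : ι → Option ℕ} {l : OpensG0 T}
    (h : ∀ m : ι → ℕ, (∀ i, o' i = some (m i)) → ⨅ i, T.simVal (X i) (o i) (o' i) ≤ l) :
    ⨅ i, T.simVal (X i) (o i) (o' i) ≤ l := by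
  by_cases ho : ∀ i, ∃ m, o' i = some m
  · choose m hm using ho
    exact h m hm
  · push Not at ho
    obtain ⟨i, hi⟩ := ho
    refine (iInf_le _ i).trans ?_
    rw [Option.eq_none_iff_forall_ne_some.2 hi, simVal_none_right]
    exact bot_le

theorem relVal_congr (R : T.sig.Rel) (o o' : Fin (T.sig.arity R) → Option ℕ) :
    T.relVal R o ⊓ ⨅ i, T.simVal (T.sig.dom R i) (o i) (o' i) ≤ T.relVal R o' := by
  rw [← le_himp_iff]
  refine relVal_le fun n hn => ?_
  rw [le_himp_iff', ← le_himp_iff]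
  refine iInf_simVal_le fun m hm => ?_
  rw [le_himp_iff, inf_comm]
  simp only [hn, hm, simVal_some]
  exact (T.atom_rel_congr R n m).trans (le_relVal hm)

end GeomTheory

/-! ### Geometric formulae at possibly undefined arguments. -/

namespace GeomFormula

open GeomTheory

variable (T : GeomTheory.{u, v, w})

/-- The propositional translation of a geometric formula at a tuple of possibly undefined
numbers. -/
noncomputable def interpVal :
    {n : ℕ} → GeomFormula.{u, v, w} T.sig n → (Fin n → Option ℕ) → OpensG0 T
  | _, .rel R t, a => T.relVal R fun i => a (t i)
  | _, .eq X i j, a => T.simVal X (a i) (a j)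
  | _, .top, _ => ⊤
  | _, .and φ ψ, a => φ.interpVal a ⊓ ψ.interpVal a
  | _, .or _ φ, a => ⨆ i, (φ i).interpVal a
  | _, .ex _ φ, a => ⨆ o : Option ℕ, φ.interpVal (Fin.cons o a)

variable {T}

/-- Geometric formulae have no negation or implication, so defining more arguments can only enlarge
the value. -/
theorem interpVal_mono : ∀ {n : ℕ} (φ : GeomFormula.{u, v, w} T.sig n) {a b : Fin n → Option ℕ},
    (∀ i k, a i = some k → b i = some k) → φ.interpVal T a ≤ φ.interpVal T b
  | _, .rel _ _, _, _, h => relVal_mono fun i => h _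
  | _, .eq _ _ _, _, _, h => simVal_mono (h _) (h _)
  | _, .top, _, _, _ => le_rfl
  | _, .and φ ψ, _, _, h => inf_le_inf (interpVal_mono φ h) (interpVal_mono ψ h)
  | _, .or _ φ, _, _, h => iSup_mono fun i => interpVal_mono (φ i) h
  | _, .ex _ φ, _, _, h => iSup_mono fun o => interpVal_mono φ fun i => by
      induction i using Fin.cases with
      | zero => exact fun k hk => hk
      | succ i => exact h i

theorem interpVal_some : ∀ {n : ℕ} (φ : GeomFormula.{u, v, w} T.sig n) (a : Fin n → ℕ),
    φ.interpVal T (fun i => some (a i)) = φ.interp T.atom a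
  | _, .rel _ _, _ => relVal_some _ _
  | _, .eq _ _ _, _ => simVal_some _ _ _
  | _, .top, _ => rfl
  | _, .and φ ψ, a => by simp only [interpVal, interp, interpVal_some]
  | _, .or _ φ, a => by simp only [interpVal, interp, interpVal_some]
  | _, .ex _ φ, a => by
    have hc : ∀ m : ℕ, φ.interpVal T (Fin.cons (some m) fun i => some (a i)) =
        φ.interp T.atom (Fin.cons m a) := fun m => by
      rw [← interpVal_some φ]
      congr 1
      funext i
      cases i using Fin.cases <;> rfl
    simp only [interpVal, interp]
    refine le_antisymm (iSup_le fun o => ?_) (iSup_le fun m => (hc m).ge.trans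
      (le_iSup (fun o => φ.interpVal T (Fin.cons o fun i => some (a i))) (some m)))
    cases o with
    | some m => exact (hc m).le.trans (le_iSup (fun m => φ.interp T.atom (Fin.cons m a)) m)
    | none =>
      -- The extra witness `none` adds nothing, being dominated by any number; `0` is an arbitrary
      -- choice.
      refine le_trans (interpVal_mono φ ?_)
        ((hc 0).le.trans (le_iSup (fun m => φ.interp T.atom (Fin.cons m a)) 0))
      intro i
      induction i using Fin.cases with
      | zero => exact fun k hk => by cases hk
      | succ i => exact fun k hk => hk

/-- Making arguments `k` undefined changes the value of a formula at most by the opens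
`[k ∼ k]`. -/
theorem interpVal_le_sup {l : OpensG0 T} :
    ∀ {n : ℕ} (φ : GeomFormula.{u, v, w} T.sig n) {Γ : Fin n → T.sig.Srt} (_ : φ.WellSorted Γ)
      {a b : Fin n → Option ℕ} (_ : ∀ i, a i = b i ∨ T.simVal (Γ i) (a i) (a i) ≤ l),
      φ.interpVal T a ≤ φ.interpVal T b ⊔ l
  | _, .rel R t, Γ, hΓ, a, b, h => by
    by_cases hab : ∀ i, a (t i) = b (t i)
    · simp only [interpVal, hab]
      exact le_sup_left
    · push Not at hab
      obtain ⟨i, hi⟩ := hab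
      -- An altered argument that occurs in an atom is bounded by its own existence, through
      -- strictness.
      refine le_sup_of_le_right ((relVal_strict R _ i).trans ?_)
      rw [← hΓ i]
      exact (h (t i)).resolve_left hi
  | _, .eq X i j, Γ, hΓ, a, b, h => by
    rcases h i with hi | hi
    · rcases h j with hj | hj
      · simp only [interpVal, hi, hj]
        exact le_sup_left
      · rw [hΓ.2] at hj
        exact le_sup_of_le_right ((simVal_right X _ _).trans hj)
    · rw [hΓ.1] at hi
      exact le_sup_of_le_right ((simVal_left X _ _).trans hi)
  | _, .top, _, _, _, _, _ => le_sup_left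
  | _, .and φ ψ, _, hΓ, _, _, h => by
    simp only [interpVal]
    rw [sup_inf_right]
    exact inf_le_inf (interpVal_le_sup φ hΓ.1 h) (interpVal_le_sup ψ hΓ.2 h)
  | _, .or _ φ, _, hΓ, _, _, h => iSup_le fun i =>
    (interpVal_le_sup (φ i) (hΓ i) h).trans
      (sup_le_sup_right (le_iSup (fun i => interpVal T (φ i) _) i) _)
  | _, .ex X φ, _, hΓ, _, b, h => iSup_le fun o =>
    (interpVal_le_sup φ (b := Fin.cons o b) hΓ fun i => by
      induction i using Fin.cases with
      | zero => exact Or.inl rfl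
      | succ i => exact h i).trans
      (sup_le_sup_right (le_iSup (fun o => φ.interpVal T (Fin.cons o b)) o) _)

end GeomFormula

/-! ### Namings, evaluation of atoms, and local families. -/

/-- A finite partial map from sorted natural numbers to natural numbers: finitely many values of a
second enumeration of a model, each given by a number of the first enumeration. -/
structure Naming (S : GeomSignature.{u, v}) where
  /-- the values -/
  val : ℕ × S.Srt → Option ℕ
  finite : {z | val z ≠ none}.Finite

namespace Naming

variable {S : GeomSignature.{u, v}}

instance : Preorder (Naming S) where
  le p q := ∀ z k, p.val z = some k → q.val z = some k
  le_refl _ _ _ h := h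
  le_trans _ _ _ h h' z k hk := h' z k (h z k hk)

instance (p : Naming S) : Finite {z // p.val z ≠ none} := p.finite

theorem exists_fresh (p : Naming S) (X : S.Srt) : ∃ m, p.val (m, X) = none := by
  by_contra! h
  exact Set.infinite_of_injective_forall_mem (Prod.mk_left_injective X) h p.finite

open Classical in
/-- The extension of a naming by one value. -/
noncomputable def extend (p : Naming S) (z : ℕ × S.Srt) (k : ℕ) : Naming S where
  val := Function.update p.val z (some k)
  finite := (p.finite.insert z).subset fun z' h => by
    by_cases hz : z' = z
    · exact Or.inl hz
    · exact Or.inr (by simpa [Function.update_of_ne hz] using h)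

open Classical in
theorem extend_self (p : Naming S) (z : ℕ × S.Srt) (k : ℕ) : (p.extend z k).val z = some k :=
  Function.update_self ..

open Classical in
theorem extend_of_ne (p : Naming S) {z z' : ℕ × S.Srt} (h : z' ≠ z) (k : ℕ) :
    (p.extend z k).val z' = p.val z' :=
  Function.update_of_ne h ..

theorem le_extend (p : Naming S) {z : ℕ × S.Srt} (hz : p.val z = none) (k : ℕ) :
    p ≤ p.extend z k := by
  intro z' k' h
  have hne : z' ≠ z := by
    rintro rfl
    rw [hz] at h
    cases h
  rwa [extend_of_ne p hne]

/-- The number in the first enumeration of the element number `n` of sort `X` on side `c`. -/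
def name (p : Naming S) : Side → S.Srt → ℕ → Option ℕ
  | .one, _, n => some n
  | .two, X, n => p.val (n, X)

theorem name_mono {p q : Naming S} (h : p ≤ q) : ∀ (c : Side) (X : S.Srt) (n k : ℕ),
    p.name c X n = some k → q.name c X n = some k
  | .one, _, _, _ => id
  | .two, _, _, _ => h _ _

variable {T : GeomTheory.{u, v, w}}

open GeomTheory

/-- The open of `G₀ᵀ` on which all values of a naming exist. -/
noncomputable def domOpen (p : Naming T.sig) : OpensG0 T :=
  ⨅ z : {z // p.val z ≠ none}, T.simVal z.1.2 (p.val z) (p.val z)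

/-- The value of a basic proposition of `T_≅` for the identity of the model in `G₀ᵀ`, where the
codomain is enumerated by a naming. -/
noncomputable def eval (p : Naming T.sig) : Atom T.sig.iso → OpensG0 T
  | .sim (c, X) n m => T.simVal X (p.name c X n) (p.name c X m)
  | .rel (.copy c R) a => T.relVal R fun i => p.name c (T.sig.dom R i) (a i)
  | .rel (.alpha X) a => T.simVal X (some (a (0 : Fin 2))) (p.val (a (1 : Fin 2), X))

theorem eval_mono {p q : Naming T.sig} (h : p ≤ q) : ∀ g, p.eval (T := T) g ≤ q.eval g
  | .sim (c, X) n m => simVal_mono (name_mono h c X n) (name_mono h c X m)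
  | .rel (.copy c R) a => relVal_mono fun i => name_mono h c (T.sig.dom R i) (a i)
  | .rel (.alpha _) _ => simVal_mono (fun _ => id) (h _)

theorem eval_copy_one (p : Naming T.sig) : ∀ g : Atom T.sig, p.eval (g.copy .one) = T.atom g
  | .sim X n m => simVal_some X n m
  | .rel R a => relVal_some R a

theorem eval_alpha (p : Naming T.sig) (X : T.sig.Srt) (n m : ℕ) :
    p.eval (T := T) (.alpha X n m) = T.simVal X (some n) (p.val (m, X)) :=
  rfl

theorem interp_copy_one (p : Naming T.sig) {n : ℕ} (φ : GeomFormula.{u, v, w} T.sig n)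
    (a : Fin n → ℕ) : (φ.copy .one).interp p.eval a = φ.interp T.atom a := by
  simp only [GeomFormula.interp_copy, eval_copy_one]

/-- A side-2 quantifier ranges over the values `p.val (m, X)`, which are among all of `Option ℕ`.
The converse can fail at a single `p`, since a witness may be unnamed; `IsLocal.interpVal_le`
repairs this. -/
theorem interp_copy_two_le (p : Naming T.sig) :
    ∀ {n : ℕ} (φ : GeomFormula.{u, v, w} T.sig n) {Γ : Fin n → T.sig.Srt} (_ : φ.WellSorted Γ)
      (a : Fin n → ℕ),
      (φ.copy .two).interp p.eval a ≤ φ.interpVal T fun i => p.val (a i, Γ i)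
  | _, .rel R t, Γ, hΓ, a => relVal_mono fun i k hk => by
    simp only [hΓ i]
    exact hk
  | _, .eq X i j, Γ, hΓ, a => by
    simp only [GeomFormula.interpVal, hΓ.1, hΓ.2]
    exact le_rfl
  | _, .top, _, _, _ => le_rfl
  | _, .and φ ψ, _, hΓ, a =>
    inf_le_inf (interp_copy_two_le p φ hΓ.1 a) (interp_copy_two_le p ψ hΓ.2 a)
  | _, .or _ φ, _, hΓ, a => iSup_mono fun i => interp_copy_two_le p (φ i) (hΓ i) a
  | _, .ex X φ, Γ, hΓ, a => iSup_le fun m => by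
    refine (interp_copy_two_le p φ hΓ (Fin.cons m a)).trans ?_
    refine le_trans (GeomFormula.interpVal_mono φ fun i => ?_)
      (le_iSup (fun o => φ.interpVal T (Fin.cons o fun i => p.val (a i, Γ i))) (p.val (m, X)))
    induction i using Fin.cases with
    | zero => exact fun k hk => hk
    | succ i => exact fun k hk => hk

/-- A family of opens indexed by namings is local if it is local for the covers that say that
every element of the model is named by some number that is not yet used. -/
def IsLocal (h : Naming T.sig → OpensG0 T) : Prop :=
  ∀ (p : Naming T.sig) (X : T.sig.Srt) (k : ℕ) (l : OpensG0 T), l ≤ T.atom (.sim X k k) →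
    (∀ m, p.val (m, X) = none → l ≤ h (p.extend (m, X) k)) → l ≤ h p

/-- Every local family contains the value of a formula on the codomain as soon as it contains its
propositional translation. -/
theorem IsLocal.interpVal_le {h : Naming T.sig → OpensG0 T} (hh : IsLocal h) :
    ∀ {n : ℕ} (φ : GeomFormula.{u, v, w} T.sig n) {Γ : Fin n → T.sig.Srt} (_ : φ.WellSorted Γ)
      (a : Fin n → ℕ) (p : Naming T.sig) (l : OpensG0 T),
      (∀ q, p ≤ q → l ⊓ (φ.copy .two).interp q.eval a ≤ h q) →
        l ⊓ φ.interpVal T (fun i => p.val (a i, Γ i)) ≤ h p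
  | _, .rel R t, Γ, hΓ, a, p, l, H => by
    refine le_trans (inf_le_inf_left l ?_) (H p le_rfl)
    exact relVal_mono fun i k hk => by
      simp only [hΓ i] at hk
      exact hk
  | _, .eq X i j, Γ, hΓ, a, p, l, H => by
    refine le_trans (inf_le_inf_left l ?_) (H p le_rfl)
    simp only [GeomFormula.interpVal, hΓ.1, hΓ.2]
    exact le_rfl
  | _, .top, _, _, _, p, _, H => H p le_rfl
  | _, .and φ ψ, Γ, hΓ, a, p, l, H => by
    simp only [GeomFormula.interpVal]
    -- The value of `ψ` is kept in `l` while `φ` is treated; `ψ` is then treated at the extended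
    -- naming `q`. This is why `H` concerns all extensions of `p`.
    rw [← inf_assoc, inf_right_comm]
    refine hh.interpVal_le φ hΓ.1 a p _ fun q hq => ?_
    rw [inf_right_comm]
    refine le_trans (inf_le_inf_left _ (GeomFormula.interpVal_mono ψ fun i => hq _))
      (hh.interpVal_le ψ hΓ.2 a q _ fun r hr => ?_)
    rw [inf_assoc]
    exact le_trans (inf_le_inf_left _ (inf_le_inf_right _
      (GeomFormula.interp_mono (eval_mono hr) _ a))) (H r (hq.trans hr))
  | _, .or _ φ, Γ, hΓ, a, p, l, H => by
    simp only [GeomFormula.interpVal, inf_iSup_eq]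
    exact iSup_le fun i => hh.interpVal_le (φ i) (hΓ i) a p l fun q hq =>
      (inf_le_inf_left _ (le_iSup (fun i => ((φ i).copy .two).interp q.eval a) i)).trans (H q hq)
  | _, .ex X φ, Γ, hΓ, a, p, l, H => by
    have ih : ∀ (q : Naming T.sig) (m : ℕ), p ≤ q →
        l ⊓ φ.interpVal T (Fin.cons (q.val (m, X)) fun i => q.val (a i, Γ i)) ≤ h q := by
      intro q m hq
      refine le_trans (inf_le_inf_left _ (GeomFormula.interpVal_mono φ fun i => ?_))
        (hh.interpVal_le φ hΓ (Fin.cons m a) q l fun r hr => le_trans (inf_le_inf_left _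
          (le_iSup (fun m => (φ.copy .two).interp r.eval (Fin.cons m a)) m)) (H r (hq.trans hr)))
      induction i using Fin.cases with
      | zero => exact fun k hk => hk
      | succ i => exact fun k hk => hk
    -- An undefined witness is the value of `p` at any fresh number.
    have hnone : l ⊓ φ.interpVal T (Fin.cons none fun i => p.val (a i, Γ i)) ≤ h p := by
      obtain ⟨m, hm⟩ := p.exists_fresh X
      simpa only [hm] using ih p m le_rfl
    simp only [GeomFormula.interpVal, inf_iSup_eq]
    refine iSup_le fun o => ?_
    cases o with
    | none => exact hnone
    | some k =>
      -- A witness `k` may be vacuous, so `φ` need not imply that `k` exists. Either `φ` already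
      -- holds with the witness undefined, or `[k ∼ k]` is available and locality lets a fresh
      -- number name `k`.
      have hs := GeomFormula.interpVal_le_sup (l := T.atom (.sim X k k)) φ hΓ
        (a := Fin.cons (some k) fun i => p.val (a i, Γ i))
        (b := Fin.cons none fun i => p.val (a i, Γ i)) fun i => by
          induction i using Fin.cases with
          | zero => exact Or.inr (simVal_some X k k).le
          | succ i => exact Or.inl rfl
      refine (le_inf le_rfl (inf_le_right.trans hs)).trans ?_
      rw [inf_sup_left]
      refine sup_le (le_trans (inf_le_inf_right _ inf_le_left) hnone) ?_
      refine hh p X k _ inf_le_right fun m hm => inf_le_left.trans ?_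
      refine le_trans (inf_le_inf_left _ (GeomFormula.interpVal_mono φ fun i => ?_))
        (ih (p.extend (m, X) k) m (p.le_extend hm k))
      induction i using Fin.cases with
      | zero => exact fun k' hk => (p.extend_self (m, X) k).trans hk
      | succ i => exact p.le_extend hm k _

end Naming

/-! ### The axioms of `P[T_≅]` against local families. -/

namespace Naming

open GeomTheory

variable {T : GeomTheory.{u, v, w}}

theorem eval_symm (p : Naming T.sig) (X : T.sig.iso.Srt) (n m : ℕ) :
    p.eval (T := T) (.sim X n m) ≤ p.eval (.sim X m n) :=
  simVal_symm _ _ _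

theorem eval_rel_congr (p : Naming T.sig) : ∀ (R : T.sig.iso.Rel)
    (n m : Fin (T.sig.iso.arity R) → ℕ),
    p.eval (T := T) (.rel R n) ⊓ ⨅ i, p.eval (.sim (T.sig.iso.dom R i) (n i) (m i)) ≤
      p.eval (.rel R m)
  | .copy _ R, _, _ => relVal_congr R _ _
  | .alpha X, n, m => by
    have h0 := iInf_le (fun i => p.eval (T := T)
      (.sim (T.sig.iso.dom (.alpha X) i) (n i) (m i))) (0 : Fin 2)
    have h1 := iInf_le (fun i => p.eval (T := T)
      (.sim (T.sig.iso.dom (.alpha X) i) (n i) (m i))) (1 : Fin 2)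
    -- With `α` read as `∼`, congruence is the chain `m 0 ∼ n 0 ∼ p.val (n 1, X) ∼ p.val (m 1, X)`.
    exact (le_inf (inf_le_right.trans (h0.trans (simVal_symm _ _ _)))
      ((inf_le_inf_left _ h1).trans (simVal_trans _ _ _ _))).trans (simVal_trans _ _ _ _)

theorem eval_rel_strict (p : Naming T.sig) : ∀ (R : T.sig.iso.Rel)
    (n : Fin (T.sig.iso.arity R) → ℕ) (i : Fin (T.sig.iso.arity R)),
    p.eval (T := T) (.rel R n) ≤ p.eval (.sim (T.sig.iso.dom R i) (n i) (n i))
  | .copy _ R, _, i => relVal_strict R _ i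
  | .alpha X, n, i => by
    change Fin 2 at i
    fin_cases i
    · exact simVal_left _ _ _
    · exact simVal_right _ _ _

theorem interp_relFwd_le (p : Naming T.sig) (R : T.sig.Rel)
    (n : Fin (GeomSequent.relFwd.{u, v, w} R).n → ℕ) :
    (GeomSequent.relFwd.{u, v, w} R).lhs.interp p.eval n ≤
      (GeomSequent.relFwd.{u, v, w} R).rhs.interp p.eval n := by
  refine le_inf inf_le_left ?_
  refine (le_inf inf_le_right (inf_le_left.trans ?_)).trans (relVal_congr R _ _)
  exact (GeomFormula.interp_bigAnd _ _ _).le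

theorem interp_relBwd_le (p : Naming T.sig) (R : T.sig.Rel)
    (n : Fin (GeomSequent.relBwd.{u, v, w} R).n → ℕ) :
    (GeomSequent.relBwd.{u, v, w} R).lhs.interp p.eval n ≤
      (GeomSequent.relBwd.{u, v, w} R).rhs.interp p.eval n := by
  refine le_inf inf_le_left ?_
  refine (le_inf inf_le_right (inf_le_left.trans ?_)).trans (relVal_congr R _ _)
  refine (GeomFormula.interp_bigAnd _ _ _).le.trans ?_
  exact iInf_mono fun i => simVal_symm _ _ _

theorem interp_alphaFun_le (p : Naming T.sig) (X : T.sig.Srt) (n : Fin 4 → ℕ) :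
    (GeomSequent.alphaFun.{u, v, w} X).lhs.interp p.eval n ≤
      (GeomSequent.alphaFun.{u, v, w} X).rhs.interp p.eval n := by
  refine le_inf inf_le_left (le_inf (inf_le_right.trans inf_le_left) ?_)
  refine le_trans (le_inf ?_ (inf_le_right.trans inf_le_left)) (simVal_trans _ _ (some (n 1)) _)
  exact le_trans (inf_le_inf (simVal_symm _ _ _) inf_le_right) (simVal_trans _ _ _ _)

theorem interp_alphaInj_le (p : Naming T.sig) (X : T.sig.Srt) (n : Fin 4 → ℕ) :
    (GeomSequent.alphaInj.{u, v, w} X).lhs.interp p.eval n ≤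
      (GeomSequent.alphaInj.{u, v, w} X).rhs.interp p.eval n := by
  refine le_inf inf_le_left (le_inf (inf_le_right.trans inf_le_left) ?_)
  refine le_trans (le_inf ?_ (inf_le_right.trans (inf_le_left.trans (simVal_symm _ _ _))))
    (simVal_trans _ _ (p.val (n 3, X)) _)
  exact le_trans (inf_le_inf le_rfl inf_le_right) (simVal_trans _ _ _ _)

theorem interp_copy_one_le (p : Naming T.sig) {σ : GeomSequent.{u, v, w} T.sig}
    (hσ : σ ∈ T.axioms) (n : Fin σ.n → ℕ) :
    (⨅ i, p.eval (.sim (.one, σ.ctx i) (n i) (n i))) ⊓ (σ.lhs.copy .one).interp p.eval n ≤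
      (σ.rhs.copy .one).interp p.eval n := by
  rw [interp_copy_one, interp_copy_one]
  refine le_trans (inf_le_inf_right _ ?_) (T.atom_ax σ hσ n)
  exact iInf_mono fun i => (simVal_some _ _ _).le

/-- The existence guards force every `p.val (n i, σ.ctx i)` to be a number `m i`. The axiom of `T`
at `m` then gives the right-hand side in the first enumeration, and locality carries it to the
second. -/
theorem IsLocal.interp_copy_two_le {h : Naming T.sig → OpensG0 T} (hh : IsLocal h)
    {σ : GeomSequent.{u, v, w} T.sig} (hσ : σ ∈ T.axioms) (n : Fin σ.n → ℕ)
    (H : ∀ q : Naming T.sig, (σ.rhs.copy .two).interp q.eval n ≤ h q) (p : Naming T.sig) :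
    (⨅ i, p.eval (.sim (.two, σ.ctx i) (n i) (n i))) ⊓ (σ.lhs.copy .two).interp p.eval n ≤
      h p := by
  have h1 := hh.interpVal_le σ.rhs σ.rhs_wellSorted n p ⊤ fun q _ => inf_le_right.trans (H q)
  rw [top_inf_eq] at h1
  refine le_trans ?_ h1
  refine le_trans (inf_le_inf_left _ (Naming.interp_copy_two_le p σ.lhs σ.lhs_wellSorted n)) ?_
  rw [← le_himp_iff]
  refine iInf_simVal_le fun m hm => ?_
  simp only [name] at hm
  rw [le_himp_iff]
  simp only [name, hm, GeomFormula.interpVal_some, simVal_some]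
  exact T.atom_ax σ hσ m

theorem IsLocal.interp_rhs_le {h : Naming T.sig → OpensG0 T} (hh : IsLocal h)
    (σ : GeomSequent.{u, max u v, w} T.sig.iso) (hσ : IsoAxiom T σ) (n : Fin σ.n → ℕ)
    (H : ∀ q, σ.rhs.interp q.eval n ≤ h q) (p : Naming T.sig) :
    (⨅ i, p.eval (.sim (σ.ctx i) (n i) (n i))) ⊓ σ.lhs.interp p.eval n ≤ h p := by
  cases hσ with
  | copy c σ hσ =>
    cases c with
    | one => exact (p.interp_copy_one_le hσ n).trans (H p)
    | two => exact hh.interp_copy_two_le hσ n H p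
  | alphaFun X => exact inf_le_right.trans ((p.interp_alphaFun_le X n).trans (H p))
  | alphaInj X => exact inf_le_right.trans ((p.interp_alphaInj_le X n).trans (H p))
  | alphaSurj X =>
    refine le_trans (inf_le_left.trans ((iInf_le _ (0 : Fin 1)).trans ?_)) (H p)
    -- The preimage of a side-2 element under `α` is its own name `k`.
    refine simVal_le fun k m hk _ => (T.atom_sim_left X k m).trans ?_
    exact (le_simVal rfl hk).trans
      (le_iSup (fun k => T.simVal X (some k) (p.val (n (0 : Fin 1), X))) k)
  | alphaTotal X =>
    refine inf_le_left.trans ((iInf_le _ (0 : Fin 1)).trans ?_)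
    refine (simVal_some X (n (0 : Fin 1)) (n (0 : Fin 1))).le.trans ?_
    -- The given element may have no second number yet; locality supplies a fresh one, which is its
    -- image under `α`.
    refine hh p X (n (0 : Fin 1)) _ le_rfl fun m _ => le_trans ?_ (H _)
    exact (le_simVal rfl (p.extend_self (m, X) _)).trans
      (le_iSup (fun m => T.simVal X (some (n (0 : Fin 1)))
        ((p.extend (_, X) (n (0 : Fin 1))).val (m, X))) m)
  | relFwd R => exact inf_le_right.trans ((p.interp_relFwd_le R n).trans (H p))
  | relBwd R => exact inf_le_right.trans ((p.interp_relBwd_le R n).trans (H p))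

/-- This replaces the inequality between the values of `U` and `W` at the same `p`, which can fail:
a bound for `W` at all namings, if local, is also one for `U`. -/
theorem IsLocal.lift_le {h : Naming T.sig → OpensG0 T} (hh : IsLocal h)
    {U W : FreeFrame (Atom T.iso.sig)} (hUW : PropAxiom T.iso U W)
    (H : ∀ q : Naming T.sig, FreeFrame.lift q.eval W ≤ h q) (p : Naming T.sig) :
    FreeFrame.lift p.eval U ≤ h p := by
  cases hUW with
  | symm X n m =>
    refine le_trans ?_ (H p)
    simp only [FreeFrame.lift_gen]
    exact p.eval_symm X n m
  | trans X n m l =>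
    refine le_trans ?_ (H p)
    simp only [map_inf, FreeFrame.lift_gen]
    exact simVal_trans _ _ _ _
  | rel_congr R n m =>
    refine le_trans ?_ (H p)
    simp only [map_inf, FrameHom.map_iInf_fin, FreeFrame.lift_gen]
    exact p.eval_rel_congr R n m
  | rel_strict R n =>
    refine le_trans ?_ (H p)
    simp only [FrameHom.map_iInf_fin, FreeFrame.lift_gen]
    exact le_iInf (p.eval_rel_strict R n)
  | ax σ hσ n =>
    simp only [GeomFormula.lift_interp, FreeFrame.lift_gen] at H
    simp only [map_inf, FrameHom.map_iInf_fin, GeomFormula.lift_interp, FreeFrame.lift_gen]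
    exact hh.interp_rhs_le σ hσ n H p

theorem domOpen_extend (p : Naming T.sig) (z : ℕ × T.sig.Srt) (k : ℕ) :
    p.domOpen ⊓ T.atom (.sim z.2 k k) ≤ (p.extend z k).domOpen (T := T) := by
  refine le_iInf fun z' => ?_
  by_cases hz : z'.1 = z
  · rw [hz, extend_self, simVal_some]
    exact inf_le_right
  · have hz' := z'.2
    rw [extend_of_ne p hz] at hz' ⊢
    exact inf_le_left.trans (iInf_le _ (⟨z'.1, hz'⟩ : {z // p.val z ≠ none}))

/-- Naming `k` by a fresh number costs `domOpen` only `[k ∼ k]`, which `e` already implies, and can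
only enlarge the value of `c`. One fresh number suffices. -/
theorem isLocal_himp (c : FreeFrame (Atom T.iso.sig)) (l : OpensG0 T) :
    IsLocal fun p : Naming T.sig => p.domOpen ⊓ FreeFrame.lift p.eval c ⇨ l := by
  intro p X k e he H
  obtain ⟨m, hm⟩ := p.exists_fresh X
  have h := H m hm
  rw [le_himp_iff] at h ⊢
  refine le_trans (le_inf inf_le_left (le_inf ?_ ?_)) h
  · exact (le_inf (inf_le_right.trans inf_le_left) (inf_le_left.trans he)).trans
      (p.domOpen_extend (m, X) k)
  · exact (inf_le_right.trans inf_le_right).trans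
      (FreeFrame.lift_mono (eval_mono (p.le_extend hm k)) c)

end Naming

/-! ### Construction of `s_!` and the counit. -/

namespace GeomTheory

variable (T : GeomTheory.{u, v, w})

/-- The left adjoint of `s^*`, on the elements of the free frame. -/
noncomputable def preShriek (U : FreeFrame (Atom T.iso.sig)) : OpensG0 T :=
  ⨆ p : Naming T.sig, p.domOpen ⊓ FreeFrame.lift p.eval U

theorem preShriek_sSup (S : Set (FreeFrame (Atom T.iso.sig))) :
    T.preShriek (sSup S) = ⨆ U ∈ S, T.preShriek U := by
  simp only [preShriek, map_sSup, sSup_image, inf_iSup_eq]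
  rw [iSup_comm]
  exact iSup_congr fun U => iSup_comm

theorem preShriek_mono : Monotone T.preShriek := fun _ _ h =>
  iSup_mono fun _ => inf_le_inf_left _ (OrderHomClass.mono _ h)

/-- The context `c` is needed because saturation is stable under meets while `preShriek` need not
preserve them. It is absorbed into the local family `isLocal_himp`. -/
theorem preShriek_inf_le {U W : FreeFrame (Atom T.iso.sig)} (h : PropAxiom T.iso U W)
    (c : FreeFrame (Atom T.iso.sig)) : T.preShriek (c ⊓ U) ≤ T.preShriek (c ⊓ W) := by
  refine iSup_le fun p => ?_
  rw [map_inf, ← inf_assoc, inf_comm, ← le_himp_iff]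
  refine (Naming.isLocal_himp c (T.preShriek (c ⊓ W))).lift_le h (fun q => ?_) p
  rw [le_himp_iff, inf_comm, inf_assoc, ← map_inf]
  exact le_iSup (fun p : Naming T.sig => p.domOpen ⊓ FreeFrame.lift p.eval (c ⊓ W)) q

theorem preShriek_proj (U : FreeFrame (Atom T.iso.sig)) :
    T.preShriek (PresentedFrame.proj (PropAxiom T.iso) U).1 = T.preShriek U := by
  apply le_antisymm
  · let s : FreeFrame (Atom T.iso.sig) := sSup {W | T.preShriek W ≤ T.preShriek U}
    have hs : ∀ W, W ≤ s ↔ T.preShriek W ≤ T.preShriek U := fun W => by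
      refine ⟨fun h => (T.preShriek_mono h).trans ?_, fun h => le_sSup h⟩
      rw [preShriek_sSup]
      exact iSup₂_le fun _ h => h
    have hmem : s ∈ saturated (PropAxiom T.iso) := fun A B hAB c hc =>
      (hs _).2 ((T.preShriek_inf_le hAB c).trans ((hs _).1 hc))
    have h2 : PresentedFrame.proj (PropAxiom T.iso) U ≤ ⟨s, hmem⟩ :=
      (saturated (PropAxiom T.iso)).giRestrict.gc.l_le ((hs U).2 le_rfl)
    exact (hs _).1 h2
  · exact T.preShriek_mono ((saturated (PropAxiom T.iso)).giRestrict.gc.le_u_l U)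

/-- The left adjoint `s_!` of `s^*`. -/
noncomputable def shriek : sSupHom (OpensG1 T) (OpensG0 T) where
  toFun b := T.preShriek b.1
  map_sSup' S := by
    have h : sSup S = PresentedFrame.proj (PropAxiom T.iso) (sSup (Subtype.val '' S)) :=
      ((saturated (PropAxiom T.iso)).giRestrict.l_sSup_u_image S).symm
    rw [h, preShriek_proj, preShriek_sSup, iSup_image, sSup_image]

theorem shriek_proj (U : FreeFrame (Atom T.iso.sig)) :
    T.shriek (PresentedFrame.proj (PropAxiom T.iso) U) =
      ⨆ p : Naming T.sig, p.domOpen ⊓ FreeFrame.lift p.eval U :=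
  T.preShriek_proj U

theorem shriek_sourceStar_le (a : OpensG0 T) : T.shriek (sourceStar T a) ≤ a := by
  have h : sourceStar T a = PresentedFrame.proj (PropAxiom T.iso)
      (FreeFrame.lift (fun g : Atom T.sig => FreeFrame.gen (g.copy .one)) a.1) :=
    (FreeFrame.map_lift _ _ _).symm
  rw [h, shriek_proj]
  refine iSup_le fun p => inf_le_right.trans ?_
  simp only [FreeFrame.map_lift, FreeFrame.lift_gen, Naming.eval_copy_one]
  refine ((PresentedFrame.proj_eq_lift (PropAxiom T) a.1).symm.trans ?_).le
  exact PresentedFrame.proj_coe _ a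

end GeomTheory

/-! ### Consequences of the isomorphism axioms in `OpensG1`, and side-2 variables. -/

namespace GeomTheory

variable (T : GeomTheory.{u, v, w})

theorem alpha_le_one (X : T.sig.Srt) (k n : ℕ) :
    T.iso.atom (.alpha X k n) ≤ T.iso.atom (.sim (.one, X) k k) :=
  T.iso.atom_rel_strict (.alpha X) ![k, n] (0 : Fin 2)

theorem alpha_le_two (X : T.sig.Srt) (k n : ℕ) :
    T.iso.atom (.alpha X k n) ≤ T.iso.atom (.sim (.two, X) n n) :=
  T.iso.atom_rel_strict (.alpha X) ![k, n] (1 : Fin 2)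

theorem interp_alpha {n : ℕ} (X : T.sig.Srt) (i j : Fin n) (a : Fin n → ℕ) :
    (GeomFormula.alpha.{u, v, w} X i j).interp T.iso.atom a =
      T.iso.atom (.alpha X (a i) (a j)) := by
  change T.iso.atom (.rel _ _) = T.iso.atom (.rel _ _)
  congr 2
  funext l
  change Fin 2 at l
  fin_cases l <;> rfl

theorem sim_two_le_iSup_alpha (X : T.sig.Srt) (n : ℕ) :
    T.iso.atom (.sim (.two, X) n n) ≤ ⨆ k, T.iso.atom (.alpha X k n) := by
  have h := T.iso.atom_ax (.alphaSurj X) (.alphaSurj X) ![n]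
  refine (le_inf (le_iInf fun i => ?_) le_top).trans (h.trans (iSup_mono fun k => ?_))
  · change Fin 1 at i
    fin_cases i
    exact le_rfl
  · exact (T.interp_alpha X 0 1 (Fin.cons k ![n])).le

theorem alpha_inf_alpha_le (X : T.sig.Srt) (k k' n n' : ℕ) :
    T.iso.atom (.alpha X k n) ⊓ T.iso.atom (.alpha X k' n') ⊓ T.iso.atom (.sim (.two, X) n n') ≤
      T.iso.atom (.sim (.one, X) k k') := by
  have h := T.iso.atom_ax (.alphaInj X) (.alphaInj X) ![k, k', n, n']
  refine le_trans (le_inf (le_iInf fun i => ?_) ?_) (h.trans (inf_le_right.trans inf_le_right))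
  · change Fin 4 at i
    fin_cases i
    · exact inf_le_left.trans (inf_le_left.trans (T.alpha_le_one X k n))
    · exact inf_le_left.trans (inf_le_right.trans (T.alpha_le_one X k' n'))
    · exact inf_le_left.trans (inf_le_left.trans (T.alpha_le_two X k n))
    · exact inf_le_left.trans (inf_le_right.trans (T.alpha_le_two X k' n'))
  · rw [inf_assoc]
    exact inf_le_inf (T.interp_alpha X 0 2 ![k, k', n, n']).ge
      (inf_le_inf (T.interp_alpha X 1 3 ![k, k', n, n']).ge le_rfl)

theorem alpha_inf_rel_two_le (R : T.sig.Rel) (k n : Fin (T.sig.arity R) → ℕ) :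
    (⨅ i, T.iso.atom (.alpha (T.sig.dom R i) (k i) (n i))) ⊓ T.iso.atom (.rel (.copy .two R) n) ≤
      T.iso.atom (.rel (.copy .one R) k) := by
  have h := T.iso.atom_ax (.relBwd R) (.relBwd R) (Fin.append k n)
  have h1 : (fun i => Fin.append k n (Fin.castAdd _ i)) = k := funext (Fin.append_left k n)
  have h2 : (fun i => Fin.append k n (Fin.natAdd _ i)) = n := funext (Fin.append_right k n)
  have h3 : (GeomFormula.rel.{u, max u v, w} (S := T.sig.iso) (.copy .one R) fun i =>
      Fin.castAdd (T.sig.arity R) i).interp T.iso.atom (Fin.append k n) =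
        T.iso.atom (.rel (.copy .one R) k) := congrArg (fun f => T.iso.atom (.rel _ f)) h1
  have h4 : (GeomFormula.rel.{u, max u v, w} (S := T.sig.iso) (.copy .two R) fun i =>
      Fin.natAdd (T.sig.arity R) i).interp T.iso.atom (Fin.append k n) =
        T.iso.atom (.rel (.copy .two R) n) := congrArg (fun f => T.iso.atom (.rel _ f)) h2
  refine le_trans (le_inf (le_iInf fun i => ?_) ?_) (h.trans (inf_le_right.trans h3.le))
  · refine inf_le_left.trans ?_
    change Fin (T.sig.arity R + T.sig.arity R) at i
    change _ ≤ T.iso.atom (.sim (Fin.append (fun i => (Side.one, T.sig.dom R i))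
      (fun i => (Side.two, T.sig.dom R i)) i) (Fin.append k n i) (Fin.append k n i))
    induction i using Fin.addCases with
    | left i =>
      simp only [Fin.append_left]
      exact (iInf_le _ i).trans (T.alpha_le_one _ _ _)
    | right i =>
      simp only [Fin.append_right]
      exact (iInf_le _ i).trans (T.alpha_le_two _ _ _)
  · refine inf_le_inf ?_ h4.ge
    refine le_trans (le_of_eq ?_) (GeomFormula.interp_bigAnd _ _ _).ge
    refine iInf_congr fun i => ?_
    refine Eq.trans ?_ (T.interp_alpha _ _ _ (Fin.append k n)).symm
    rw [Fin.append_left, Fin.append_right]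

end GeomTheory

namespace Atom

variable {S : GeomSignature.{u, v}}

/-- The variables on side `2` that occur in a basic proposition of `T_≅`. -/
def sideTwoVars : Atom S.iso → Set (ℕ × S.Srt)
  | .sim (.two, X) n m => {(n, X), (m, X)}
  | .rel (.copy .two R) a => Set.range fun i => (a i, S.dom R i)
  | .rel (.alpha X) a => {(a (1 : Fin 2), X)}
  | _ => ∅

theorem finite_vars : ∀ g : Atom S, g.vars.Finite
  | .sim _ _ _ => (Set.finite_singleton _).insert _
  | .rel _ _ => Set.finite_range _

theorem finite_sideTwoVars : ∀ g : Atom S.iso, g.sideTwoVars.Finite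
  | .sim (.one, _) _ _ => Set.finite_empty
  | .sim (.two, _) _ _ => (Set.finite_singleton _).insert _
  | .rel (.copy .one _) _ => Set.finite_empty
  | .rel (.copy .two R) _ => Set.finite_range (ι := Fin (S.arity R)) _
  | .rel (.alpha _) _ => Set.finite_singleton _

theorem alpha_eta (X : S.Srt) (a : Fin 2 → ℕ) :
    Atom.rel (S := S.iso) (.alpha X) a = .alpha X (a 0) (a 1) := by
  unfold alpha
  congr 1
  funext i
  change Fin 2 at i
  fin_cases i <;> rfl

theorem atom_le_of_mem_sideTwoVars (T : GeomTheory.{u, v, w}) : ∀ (g : Atom T.sig.iso) {z},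
    z ∈ g.sideTwoVars → T.iso.atom g ≤ T.iso.atom (.sim (.two, z.2) z.1 z.1)
  | .sim (.one, _) _ _, _, hz => hz.elim
  | .sim (.two, X) n m, _, hz => by
    rcases hz with rfl | rfl
    · exact T.iso.atom_sim_left (.two, X) n m
    · exact T.iso.atom_sim_right (.two, X) n m
  | .rel (.copy .one _) _, _, hz => hz.elim
  | .rel (.copy .two R) a, _, hz => by
    obtain ⟨i, rfl⟩ := hz
    exact T.iso.atom_rel_strict (.copy .two R) a i
  | .rel (.alpha X) a, _, hz => by
    obtain rfl := hz
    exact T.iso.atom_rel_strict (.alpha X) a (1 : Fin 2)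

end Atom

/-! ### Covering by graphs of namings. -/

namespace Naming

open GeomTheory

variable {T : GeomTheory.{u, v, w}}

/-- The open of `G₁ᵀ` on which a naming describes the isomorphism. -/
noncomputable def graphOpen (p : Naming T.sig) : OpensG1 T :=
  ⨅ (z : ℕ × T.sig.Srt) (k : ℕ) (_ : p.val z = some k), T.iso.atom (.alpha z.2 k z.1)

theorem graphOpen_le {p : Naming T.sig} {n : ℕ} {X : T.sig.Srt} {k : ℕ}
    (h : p.val (n, X) = some k) : p.graphOpen (T := T) ≤ T.iso.atom (.alpha X k n) :=
  (iInf_le _ (n, X)).trans (iInf₂_le k h)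

/-- Induction on `V`: surjectivity of `α` gives each existing side-2 element a preimage, which
serves as its name. -/
theorem le_iSup_graphOpen {V : Set (ℕ × T.sig.Srt)} (hV : V.Finite) {b : OpensG1 T}
    (h : ∀ z ∈ V, b ≤ T.iso.atom (.sim (.two, z.2) z.1 z.1)) :
    b ≤ ⨆ (p : Naming T.sig) (_ : ∀ z ∈ V, p.val z ≠ none), p.graphOpen := by
  induction V, hV using Set.Finite.induction_on with
  | empty =>
    refine le_iSup₂_of_le ⟨fun _ => none, by simp⟩ (fun _ hz => hz.elim) ?_
    exact le_iInf fun _ => le_iInf₂ fun _ hk => by cases hk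
  | @insert z V _ _ ih =>
    refine (le_inf (ih fun z' hz' => h z' (Or.inr hz'))
      ((h z (Or.inl rfl)).trans (T.sim_two_le_iSup_alpha z.2 z.1))).trans ?_
    simp only [iSup_inf_eq, inf_iSup_eq]
    -- If `p` already has a value at `z`, it is overwritten; the graph clauses at other variables
    -- are unaffected.
    refine iSup_le fun k => iSup₂_le fun p hp => le_iSup₂_of_le (p.extend z k) ?_ ?_
    · intro z' hz'
      by_cases hz : z' = z
      · rw [hz, extend_self]
        exact Option.some_ne_none k
      · rw [extend_of_ne p hz]
        exact hp z' (hz'.resolve_left hz)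
    · refine le_iInf fun z' => le_iInf₂ fun k' hk' => ?_
      by_cases hz : z' = z
      · rw [hz, extend_self] at hk'
        rw [hz, ← Option.some.inj hk']
        exact inf_le_right
      · rw [extend_of_ne p hz] at hk'
        exact inf_le_left.trans (graphOpen_le hk')

theorem graphOpen_le_sourceStar_domOpen (p : Naming T.sig) :
    p.graphOpen ≤ sourceStar T p.domOpen := by
  rw [domOpen, FrameHom.map_iInf_finite]
  refine le_iInf fun z => ?_
  obtain ⟨k, hk⟩ := Option.ne_none_iff_exists'.1 z.2
  rw [hk, simVal_some, sourceStar_atom]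
  exact (graphOpen_le hk).trans (T.alpha_le_one _ _ _)

/-- On `graphOpen` the isomorphism sends each name to the element it names, so preservation and
injectivity pull an atom back to side 1. This is the unit on a single atom. -/
theorem atom_inf_graphOpen_le (p : Naming T.sig) : ∀ g : Atom T.sig.iso,
    (∀ z ∈ g.sideTwoVars, p.val z ≠ none) →
      T.iso.atom g ⊓ p.graphOpen ≤ sourceStar T (p.eval g)
  | .sim (.one, X) n m, _ => by
    simp only [eval, name, simVal_some, sourceStar_atom]
    exact inf_le_left
  | .rel (.copy .one R) a, _ => by
    simp only [eval, name, relVal_some, sourceStar_atom]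
    exact inf_le_left
  | .sim (.two, X) n m, h => by
    obtain ⟨k, hk⟩ := Option.ne_none_iff_exists'.1 (h (n, X) (Or.inl rfl))
    obtain ⟨k', hk'⟩ := Option.ne_none_iff_exists'.1 (h (m, X) (Or.inr rfl))
    simp only [eval, name, hk, hk', simVal_some, sourceStar_atom]
    refine le_trans (le_inf (inf_le_right.trans ?_) inf_le_left) (T.alpha_inf_alpha_le X k k' n m)
    exact le_inf (graphOpen_le hk) (graphOpen_le hk')
  | .rel (.copy .two R) a, h => by
    have h' : ∀ i : Fin (T.sig.arity R), ∃ k, p.val (a i, T.sig.dom R i) = some k := fun i =>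
      Option.ne_none_iff_exists'.1 (h _ ⟨i, rfl⟩)
    choose k hk using h'
    simp only [eval, name, hk, relVal_some, sourceStar_atom]
    refine le_trans (le_inf (inf_le_right.trans ?_) inf_le_left) (T.alpha_inf_rel_two_le R k a)
    exact le_iInf fun i => graphOpen_le (hk i)
  | .rel (.alpha X) a, h => by
    obtain ⟨k, hk⟩ := Option.ne_none_iff_exists'.1 (h (a (1 : Fin 2), X) rfl)
    simp only [eval, hk, simVal_some, sourceStar_atom]
    rw [Atom.alpha_eta]
    refine le_trans ?_ (T.alpha_inf_alpha_le X (a (0 : Fin 2)) k (a (1 : Fin 2)) (a (1 : Fin 2)))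
    exact le_inf (inf_le_inf_left _ (graphOpen_le hk)) (inf_le_left.trans (T.alpha_le_two _ _ _))

theorem eval_copy_two_subst (p : Naming T.sig) : ∀ (g : Atom T.sig) (y : g.vars → ℕ),
    (∀ z : g.vars, p.val z = some (y z)) → p.eval (g.copy .two) = T.atom (g.subst y)
  | .sim X n m, y, hy => by
    have h1 : p.val (n, X) = _ := hy ⟨(n, X), Or.inl rfl⟩
    have h2 : p.val (m, X) = _ := hy ⟨(m, X), Or.inr rfl⟩
    simp only [Atom.copy, eval, name, h1, h2, simVal_some, Atom.subst]
  | .rel R a, y, hy => by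
    have h : ∀ i, p.val (a i, T.sig.dom R i) = _ := fun i => hy ⟨(a i, T.sig.dom R i), i, rfl⟩
    simp only [Atom.copy, eval, name, h, relVal_some, Atom.subst]

/-- By strictness a side-2 atom vanishes if one of its variables is unnamed, and otherwise supplies
the existence clause of `domOpen`. -/
theorem eval_copy_two_le (p : Naming T.sig) : ∀ (g : Atom T.sig) {z}, z ∈ g.vars →
    p.eval (g.copy .two) ≤ T.simVal z.2 (p.val z) (p.val z)
  | .sim X n m, _, hz => by
    rcases hz with rfl | rfl
    · exact simVal_left _ _ _
    · exact simVal_right _ _ _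
  | .rel R a, _, hz => by
    obtain ⟨i, rfl⟩ := hz
    exact relVal_strict R _ i

end Naming

/-! ### The adjunction, the explicit formula and uniqueness. -/

namespace GeomTheory

variable (T : GeomTheory.{u, v, w})

theorem eq_iSup_iInf_atom (b : OpensG0 T) :
    b = ⨆ F ∈ b.1, ⨅ g ∈ OrderDual.ofDual F, T.atom g :=
  (PresentedFrame.proj_coe _ b).symm.trans (PresentedFrame.proj_eq_lift _ b.1)

theorem le_sourceStar_shriek (b : OpensG1 T) : b ≤ sourceStar T (T.shriek b) := by
  conv_lhs => rw [T.iso.eq_iSup_iInf_atom b]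
  refine iSup₂_le fun F hF => ?_
  let V : Set (ℕ × T.sig.Srt) := ⋃ g ∈ OrderDual.ofDual F, g.sideTwoVars
  have hV : V.Finite := (OrderDual.ofDual F).finite_toSet.biUnion fun g _ => g.finite_sideTwoVars
  have hle := Naming.le_iSup_graphOpen hV
    (b := ⨅ g ∈ OrderDual.ofDual F, T.iso.atom g) fun z hz => by
      obtain ⟨g, hg, hz⟩ := Set.mem_iUnion₂.1 hz
      exact (iInf₂_le g hg).trans (g.atom_le_of_mem_sideTwoVars T hz)
  refine (le_inf le_rfl hle).trans ?_
  simp only [inf_iSup_eq]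
  refine iSup₂_le fun p hp => ?_
  have h1 : p.domOpen ⊓ (⨅ g ∈ OrderDual.ofDual F, p.eval g) ≤ T.shriek b :=
    le_iSup_of_le p (inf_le_inf_left _ (le_iSup₂_of_le F hF le_rfl))
  refine le_trans ?_ (OrderHomClass.mono (sourceStar T) h1)
  rw [map_inf, ← Finset.inf_eq_iInf (OrderDual.ofDual F) p.eval, map_finset_inf]
  refine le_inf (inf_le_right.trans p.graphOpen_le_sourceStar_domOpen)
    (Finset.le_inf fun g hg => ?_)
  exact (inf_le_inf_right _ (iInf₂_le g hg)).trans (p.atom_inf_graphOpen_le g fun z hz =>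
    hp z (Set.mem_iUnion₂.2 ⟨g, hg, hz⟩))

theorem gc_shriek_sourceStar : GaloisConnection T.shriek (sourceStar T) := fun b a =>
  ⟨fun h => (T.le_sourceStar_shriek b).trans (OrderHomClass.mono _ h),
    fun h => (OrderHomClass.mono T.shriek h).trans (T.shriek_sourceStar_le a)⟩

theorem shriek_basicOpen_eq_iSup {I J K : Type*} [Finite I] [Finite J] [Finite K]
    (A : I → Atom T.sig) (B : J → Atom T.sig) (X : K → T.sig.Srt) (c d : K → ℕ) :
    T.shriek (basicOpen T A B X c d) = ⨆ p : Naming T.sig, p.domOpen ⊓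
      ((⨅ i, T.atom (A i)) ⊓ (⨅ j, p.eval ((B j).copy .two)) ⊓
        ⨅ k, T.simVal (X k) (some (c k)) (p.val (d k, X k))) := by
  have h : basicOpen T A B X c d = PresentedFrame.proj (PropAxiom T.iso)
      ((⨅ i, FreeFrame.gen ((A i).copy .one)) ⊓ (⨅ j, FreeFrame.gen ((B j).copy .two)) ⊓
        ⨅ k, FreeFrame.gen (.alpha (X k) (c k) (d k))) := by
    simp only [map_inf, FrameHom.map_iInf_finite]
    rfl
  rw [h, shriek_proj]
  simp only [map_inf, FrameHom.map_iInf_finite, FreeFrame.lift_gen, Naming.eval_copy_one,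
    Naming.eval_alpha]

theorem shriek_basicOpen {I J K : Type*} [Finite I] [Finite J] [Finite K]
    (A : I → Atom T.sig) (B : J → Atom T.sig) (X : K → T.sig.Srt) (c d : K → ℕ) :
    T.shriek (basicOpen T A B X c d) = imageOpen T A B X c d := by
  classical
  rw [shriek_basicOpen_eq_iSup, imageOpen, inf_iSup_eq]
  apply le_antisymm
  · refine iSup_le fun p => ?_
    by_cases hp : ∀ z : codVars B X d, ∃ k, p.val z = some k
    · choose y hy using hp
      refine inf_le_right.trans (le_iSup_of_le y ?_)
      rw [inf_assoc]
      refine inf_le_inf_left _ (inf_le_inf (iInf_mono fun j => ?_) (iInf_mono fun k => ?_))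
      · exact (p.eval_copy_two_subst (B j) _ fun z =>
          hy ⟨z, Or.inl (Set.mem_iUnion.2 ⟨j, z.2⟩)⟩).le
      · refine simVal_le fun n m hn hm => ?_
        have := (hy ⟨(d k, X k), Or.inr ⟨k, rfl⟩⟩).symm.trans hm
        rw [Option.some.inj hn, ← Option.some.inj this]
        exact le_rfl
    -- A variable of `V` without a name makes one of the factors `⊥`.
    · push Not at hp
      obtain ⟨⟨z, hz⟩, hp⟩ := hp
      have hnone : p.val z = none := Option.eq_none_iff_forall_ne_some.2 hp
      have hbot : T.simVal z.2 (p.val z) (p.val z) = ⊥ := by rw [hnone, simVal_none_right]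
      refine le_trans (inf_le_right.trans ?_) (hbot.le.trans bot_le)
      rcases hz with hz | ⟨k, rfl⟩
      · obtain ⟨j, hj⟩ := Set.mem_iUnion.1 hz
        exact (inf_le_left.trans inf_le_right).trans
          ((iInf_le _ j).trans (p.eval_copy_two_le (B j) hj))
      · exact inf_le_right.trans ((iInf_le _ k).trans (simVal_right _ _ _))
  · refine iSup_le fun y => ?_
    have hfin : (codVars B X d).Finite :=
      (Set.finite_iUnion fun j => (B j).finite_vars).union (Set.finite_range _)
    -- The domain of this naming is exactly `V`, so its `domOpen` already follows from the atoms
    -- that involve `V`.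
    let p : Naming T.sig :=
      { val := fun z => if h : z ∈ codVars B X d then some (y ⟨z, h⟩) else none
        finite := hfin.subset fun z hz => by
          by_contra h
          exact hz (dif_neg h) }
    have hp : ∀ z : codVars B X d, p.val z = some (y z) := fun z => dif_pos z.2
    have hB : ∀ j, p.eval ((B j).copy .two) = T.atom ((B j).subst (projAtom B X d j y)) :=
      fun j => p.eval_copy_two_subst (B j) _ fun z =>
        hp ⟨z, Or.inl (Set.mem_iUnion.2 ⟨j, z.2⟩)⟩
    have hK : ∀ k, T.simVal (X k) (some (c k)) (p.val (d k, X k)) =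
        T.atom (.sim (X k) (c k) (projVal B X d k y)) := fun k => by
      rw [hp ⟨(d k, X k), Or.inr ⟨k, rfl⟩⟩, simVal_some]
      rfl
    refine le_iSup_of_le p ?_
    simp only [← hB, ← hK]
    rw [← inf_assoc]
    refine le_inf (le_iInf fun z => ?_) le_rfl
    have hz : z.1 ∈ codVars B X d := by
      by_contra h
      exact z.2 (dif_neg h)
    rcases hz with hz | ⟨k, hk⟩
    · obtain ⟨j, hj⟩ := Set.mem_iUnion.1 hz
      exact (inf_le_left.trans inf_le_right).trans
        ((iInf_le _ j).trans (p.eval_copy_two_le (B j) hj))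
    · rw [← hk]
      exact inf_le_right.trans ((iInf_le _ k).trans (simVal_right _ _ _))

/-- Every atom of `T_≅` is of one of the three kinds in `basicOpen`, so each new atom enlarges one
index type by `Option`. Hence basic opens generate under joins, which gives uniqueness. -/
theorem exists_eq_basicOpen (F : Finset (Atom T.iso.sig)) :
    ∃ (I J K : Type) (_ : Finite I) (_ : Finite J) (_ : Finite K) (A : I → Atom T.sig)
      (B : J → Atom T.sig) (X : K → T.sig.Srt) (c d : K → ℕ),
      ⨅ g ∈ F, T.iso.atom g = basicOpen T A B X c d := by
  classical
  induction F using Finset.induction_on with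
  | empty =>
    refine ⟨Empty, Empty, Empty, inferInstance, inferInstance, inferInstance, Empty.elim,
      Empty.elim, Empty.elim, Empty.elim, Empty.elim, ?_⟩
    simp only [basicOpen, Finset.notMem_empty, iInf_of_empty, iInf_top, inf_top_eq]
  | insert g F _ ih =>
    obtain ⟨I, J, K, _, _, _, A, B, X, c, d, h⟩ := ih
    rw [Finset.iInf_insert, h]
    have hone : ∀ g' : Atom T.sig, T.iso.atom (g'.copy .one) ⊓ basicOpen T A B X c d =
        basicOpen T (fun i : Option I => i.elim g' A) B X c d := fun g' => by
      simp only [basicOpen, iInf_option, Option.elim_none, Option.elim_some, inf_assoc]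
    have htwo : ∀ g' : Atom T.sig, T.iso.atom (g'.copy .two) ⊓ basicOpen T A B X c d =
        basicOpen T A (fun j : Option J => j.elim g' B) X c d := fun g' => by
      simp only [basicOpen, iInf_option, Option.elim_none, Option.elim_some, inf_assoc]
      rw [inf_left_comm]
    match g with
    | .sim (.one, Y) n m =>
      exact ⟨_, _, _, inferInstance, ‹_›, ‹_›, _, _, _, _, _, hone (.sim Y n m)⟩
    | .sim (.two, Y) n m =>
      exact ⟨_, _, _, ‹_›, inferInstance, ‹_›, _, _, _, _, _, htwo (.sim Y n m)⟩
    | .rel (.copy .one R) a =>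
      exact ⟨_, _, _, inferInstance, ‹_›, ‹_›, _, _, _, _, _, hone (.rel R a)⟩
    | .rel (.copy .two R) a =>
      exact ⟨_, _, _, ‹_›, inferInstance, ‹_›, _, _, _, _, _, htwo (.rel R a)⟩
    | .rel (.alpha Y) a =>
      refine ⟨I, J, Option K, ‹_›, ‹_›, inferInstance, A, B, fun k => k.elim Y X,
        fun k => k.elim (a (0 : Fin 2)) c, fun k => k.elim (a (1 : Fin 2)) d, ?_⟩
      simp only [basicOpen, iInf_option, Option.elim_none, Option.elim_some]
      rw [Atom.alpha_eta, inf_left_comm]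

theorem sSupHom_ext_basicOpen {h h' : sSupHom (OpensG1 T) (OpensG0 T)}
    (H : ∀ (I J K : Type) [Finite I] [Finite J] [Finite K] (A : I → Atom T.sig)
      (B : J → Atom T.sig) (X : K → T.sig.Srt) (c d : K → ℕ),
      h (basicOpen T A B X c d) = h' (basicOpen T A B X c d)) : h = h' := by
  ext1 b
  rw [T.iso.eq_iSup_iInf_atom b]
  simp only [map_iSup]
  refine iSup_congr fun F => iSup_congr fun _ => ?_
  obtain ⟨I, J, K, _, _, _, A, B, X, c, d, hF⟩ := T.exists_eq_basicOpen (OrderDual.ofDual F)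
  rw [hF, H]

end GeomTheory

theorem mainTheorem3 (T : GeomTheory.{u, v, w}) :
    ∃ sShriek : sSupHom (OpensG1 T) (OpensG0 T),
      GaloisConnection sShriek (sourceStar T) ∧
      (∀ (I J K : Type) [Finite I] [Finite J] [Finite K] (A : I → Atom T.sig)
        (B : J → Atom T.sig) (X : K → T.sig.Srt) (c d : K → ℕ),
        sShriek (basicOpen T A B X c d) = imageOpen T A B X c d) ∧
      ∀ h : sSupHom (OpensG1 T) (OpensG0 T),
        (∀ (I J K : Type) [Finite I] [Finite J] [Finite K] (A : I → Atom T.sig)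
          (B : J → Atom T.sig) (X : K → T.sig.Srt) (c d : K → ℕ),
          h (basicOpen T A B X c d) = imageOpen T A B X c d) → h = sShriek :=
  ⟨T.shriek, T.gc_shriek_sourceStar, fun _ _ _ _ _ _ A B X c d => T.shriek_basicOpen A B X c d,
    fun _ hh => T.sSupHom_ext_basicOpen fun I J K _ _ _ A B X c d =>
      (hh I J K A B X c d).trans (T.shriek_basicOpen A B X c d).symm⟩
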